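/- **Setting.** Let $d,m\ge 0$, $L\ge 1$, $N\geq 0$ be integers and let $\sigma\in\mathbb R[x]$ be a polynomial of degree $k$. For weights $\mathcal W^*=(a^*,W_1^*,\dots,W_L^*)$ with $a^*\in\mathbb R^m$, $W_1^*\in\mathbb R^{m\times d}$ and $W_p^*\in\mathbb R^{m\times m}$ for $2\le p\le L$, let $$f(\mathcal W^*,x)=(a^*)^T\sigma\big(W_L^*\,\sigma(W_{L-1}^*\cdots\sigma(W_1^*x))\cdots\big),\qquad x\in\mathbb R^d,$$ with $\sigma$ applied coordinatewise (for $\sigma=0$ put $k=0$). The data $X^{(1)},\dots,X^{(N)}\in\mathbb R^d$ are i.i.d. random vectors, and $Y_i=f(\mathcal W^*,X^{(i)})$. **T-OLS.** For $s,t\ge 0$ let $\mathcal F_{s,t}=\{\alpha\in\mathbb Z^d:\sum_i\alpha_i=t,\ 0\le\alpha_i\le s\}$. For a cardinality $q\in\{1,2,\dots\}\cup\{\infty\}$ let $\omega(q,t)=\min\{q-1,t\}$. T-OLS with degree $M$ and cardinality $q$ chooses coefficients $\mathcal T^{(t)}_\alpha$, for $0\le t\le M$ and $\alpha\in\mathcal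 F_{\omega(q,t),t}$, that minimize $$\sum_{i=1}^N\Big(Y_i-\sum_{t=0}^M\sum_{\alpha\in\mathcal F_{\omega(q,t),t}}\mathcal T^{(t)}_\alpha (X^{(i)})^\alpha\Big)^2,\qquad x^\alpha=\prod_j x_j^{\alpha_j},$$ and outputs $\widehat h(x)=\sum_{t=0}^M\sum_{\alpha\in\mathcal F_{\omega(q,t),t}}\mathcal T^{(t)}_\alpha x^\alpha$. If there are several minimizers, each of them gives an output; the statements below hold for every output, and an output exists. **The constant.** For a probability distribution $P$ on $[-1,1]$ with support $S$, put $c_n=\mathbb E_P[X^n]$, $D_n=\det(c_{i+j})_{0\le i,j\le n}$, $D_{-1}=1$, $\omega=\min\{|S|-1,K\}$, $r_i=D_i/D_{i-1}$, and $$c(P,K)=\min\Big\{\min_{0\le i\le\omega}r_i^{K/2},\,1\Big\},\qquad f(P,K)=\max\{c_{2\omega}^K,1\}\,\frac{\max\{\max_{0\le i\le\omega}r_i^K,1\}}{\min\{\min_{0\le i\le\omega}r_i^K,1\}},\qquad C(P,K)=\frac{f(P,K)}{c(P,K)} .$$ **Theorem.** There is an absolute constant $c'>0$ for which the following holds. (a)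 Suppose that the coordinates of each $X^{(i)}$ are i.i.d. with a non-constant distribution $P$ supported in $[-1,1]$, and let $S=\mathrm{Support}(P)$. If $$N> d^{\,24k^L}\,C(P,k^L)^4,$$ then, with probability at least $1-\exp(-c'N^{1/4})$, the output $\widehat h$ of T-OLS with degree $k^L$ and cardinality $|S|$ satisfies $\widehat h(x)=f(\mathcal W^*,x)$ for all $x\in S^d$ and, if $|S|>k^L$ (in particular if $S$ is infinite), $\widehat h(x)=f(\mathcal W^*,x)$ for all $x\in\mathbb R^d$. (b) Suppose instead that each $X^{(i)}$ has a joint density with respect to Lebesgue measure on $\mathbb R^d$. If $$N\ \ge\ \sum_{t=0}^{k^L}|\mathcal F_{t,t}|=\sum_{t=0}^{k^L}\binom{d+t-1}{t},$$ then, almost surely, the output $\widehat h$ of T-OLS with degree $k^L$ and cardinality $+\infty$ satisfies $\widehat h(x)=f(\mathcal W^*,x)$ for all $x\in\mathbb R^d$. -/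

import Mathlib

open MeasureTheory ProbabilityTheory

namespace PolyNet

/-- Weights of a network of depth `L ≥ 1`, width `m` and input dimension `d`: the output weights `a`,
the first layer `W₁ ∈ ℝ^{m×d}`, and the layers `W₂, …, W_L ∈ ℝ^{m×m}` (`rest 0` is `W₂`). -/
structure Weights (d m L : ℕ) where
  a : Fin m → ℝ
  first : Matrix (Fin m) (Fin d) ℝ
  rest : Fin (L - 1) → Matrix (Fin m) (Fin m) ℝ

/-- The network function `x ↦ aᵀ σ(W_L σ(W_{L-1} ⋯ σ(W₁ x)))`, with `σ` acting coordinatewise. -/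
noncomputable def Weights.eval {d m L : ℕ} (w : Weights d m L) (σ : ℝ → ℝ) (x : Fin d → ℝ) : ℝ :=
  dotProduct w.a
    ((List.ofFn w.rest).foldl (fun h A => fun j => σ (A.mulVec h j))
      (fun j => σ (w.first.mulVec x j)))

/-- `ω = min (|S| - 1, t)`, for a cardinality `|S|` that may be infinite. -/
noncomputable def omega (card : ℕ∞) (t : ℕ) : ℕ := (min (card - 1) (t : ℕ∞)).toNat

/-- The set `F_{s,t}` of multi-indices `α ∈ {0,…,s}^d` with `∑ αᵢ = t`. -/
def multiplicities (d s t : ℕ) : Finset (Fin d → ℕ) :=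
  (Finset.piAntidiag Finset.univ t).filter fun α => ∀ i, α i ≤ s

/-- Families of coefficient vectors `(𝒯^{(t)} : 0 ≤ t ≤ M)`, with `𝒯^{(t)}` indexed by
`F_{ω(S,t),t}`. -/
abbrev Coeffs (d M : ℕ) (card : ℕ∞) : Type :=
  (t : Fin (M + 1)) → multiplicities d (omega card t) t → ℝ

/-- The function `x ↦ ∑_{t ≤ M} ⟨Ξ^{(t)}(x), 𝒯^{(t)}⟩`, where `Ξ^{(t)}(x)` is the vector of the
monomials `x^α`, `α ∈ F_{ω(S,t),t}`. -/
noncomputable def predictor {d M : ℕ} {card : ℕ∞} (T : Coeffs d M card) (x : Fin d → ℝ) : ℝ :=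
  ∑ t : Fin (M + 1), ∑ α : multiplicities d (omega card t) t, (∏ i, x i ^ α.1 i) * T t α

/-- The least squares objective of T-OLS. -/
noncomputable def olsLoss {d M N : ℕ} {card : ℕ∞} (X : Fin N → Fin d → ℝ) (Y : Fin N → ℝ)
    (T : Coeffs d M card) : ℝ :=
  ∑ i, (Y i - predictor T (X i)) ^ 2

/-- `h` is an output of T-OLS on the data `(X i, Y i)`, the degree `M` and the cardinality `card`:
the prediction function of some global minimizer of the least squares problem. -/
def IsTOLSOutput {d N : ℕ} (X : Fin N → Fin d → ℝ) (Y : Fin N → ℝ) (M : ℕ) (card : ℕ∞)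
    (h : (Fin d → ℝ) → ℝ) : Prop :=
  ∃ T : Coeffs d M card, (∀ T' : Coeffs d M card, olsLoss X Y T ≤ olsLoss X Y T') ∧ h = predictor T

/-- T-OLS recovers `f` on the set `A`: it has an output, and all of its outputs (there may be several
if the least squares problem is degenerate) agree with `f` on `A`. -/
def Recovers {d N : ℕ} (X : Fin N → Fin d → ℝ) (Y : Fin N → ℝ) (M : ℕ) (card : ℕ∞)
    (f : (Fin d → ℝ) → ℝ) (A : Set (Fin d → ℝ)) : Prop :=
  (∃ h, IsTOLSOutput X Y M card h) ∧ ∀ h, IsTOLSOutput X Y M card h → ∀ x ∈ A, h x = f x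

/-- The law `P` of a coordinate in an admissible input distribution `P^{⊗d}`: a non-constant
probability distribution on `[-1, 1]`. -/
structure IsAdmissible (P : Measure ℝ) : Prop where
  isProbabilityMeasure : IsProbabilityMeasure P
  support_subset : P.support ⊆ Set.Icc (-1) 1
  nonconstant : ∀ x : ℝ, P ≠ Measure.dirac x

/-- The data `X 0, …, X (N-1)` are i.i.d. with law `D`. -/
structure IsIIDSample {Ω : Type*} [MeasurableSpace Ω] (μ : Measure Ω) {d N : ℕ}
    (X : Fin N → Ω → Fin d → ℝ) (D : Measure (Fin d → ℝ)) : Prop where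
  measurable : ∀ i, Measurable (X i)
  indep : iIndepFun X μ
  law : ∀ i, μ.map (X i) = D

/-- The `n`-th moment of `P`. -/
noncomputable def rawMoment (P : Measure ℝ) (n : ℕ) : ℝ := ∫ x, x ^ n ∂P

/-- The Hankel determinant `D_n = det (c_{i+j})_{0 ≤ i, j ≤ n}` of the moments of `P`. -/
noncomputable def hankelDet (P : Measure ℝ) (n : ℕ) : ℝ :=
  (Matrix.of fun i j : Fin (n + 1) => rawMoment P (i + j)).det

/-- The ratio `D_i / D_{i-1}`, with the convention `D_{-1} = 1`. -/
noncomputable def hankelRatio (P : Measure ℝ) : ℕ → ℝ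
  | 0 => hankelDet P 0
  | i + 1 => hankelDet P (i + 1) / hankelDet P i

/-- `ω(P,k) = min (|Support P| - 1, k)`. -/
noncomputable def omegaP (P : Measure ℝ) (k : ℕ) : ℕ := omega P.support.encard k

/-- `c(P,k) = min (min_{i ≤ ω(P,k)} (D_i / D_{i-1})^{k/2}, 1)`. -/
noncomputable def lowerConst (P : Measure ℝ) (k : ℕ) : ℝ :=
  min ((Finset.range (omegaP P k + 1)).inf' Finset.nonempty_range_add_one
    fun i => hankelRatio P i ^ ((k : ℝ) / 2)) 1

/-- `f(P,k) = max (c_{2ω(P,k)}^k, 1) · max (max_i (D_i/D_{i-1})^k, 1) / min (min_i (D_i/D_{i-1})^k, 1)`,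
with `i` ranging over `0, …, ω(P,k)`. -/
noncomputable def upperConst (P : Measure ℝ) (k : ℕ) : ℝ :=
  max (rawMoment P (2 * omegaP P k) ^ k) 1 *
    (max ((Finset.range (omegaP P k + 1)).sup' Finset.nonempty_range_add_one
        fun i => hankelRatio P i ^ k) 1 /
      min ((Finset.range (omegaP P k + 1)).inf' Finset.nonempty_range_add_one
        fun i => hankelRatio P i ^ k) 1)

/-- The constant `C(P,k) = f(P,k) / c(P,k)`. -/
noncomputable def condConst (P : Measure ℝ) (k : ℕ) : ℝ := upperConst P k / lowerConst P k

end PolyNet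

/-! A network of depth `L` is a polynomial of total degree at most `k ^ L`. On the grid `S ^ d` it
agrees with a polynomial of degree below `|S|` in each variable, so T-OLS can represent it and
attains loss zero. Every minimizer then interpolates the data, and recovery can fail only on a
`degenerate` sample, where some nonzero coefficient vector gives a polynomial vanishing at all data
points.

The samples are revealed one at a time, keeping the subspace of polynomials that vanish so far. If a
fixed nonzero element of it is nonzero at the next point, the dimension drops. If every nonzero
polynomial is nonzero with probability at least `β`, degeneracy is thus no likelier than fewer than
`D` successes in `n` Bernoulli(`β`) trials, where `D` is the dimension
(`measure_degenerate_le_binomTail`). No eigenvalue estimate for the Gram matrix is needed. With a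
density, `β = 1`, and `N ≥ D` suffices almost surely.

For product laws, `β` comes from a Schwartz–Zippel induction on the variables. In one variable, `D_j
/ D_{j-1}` is at most `∫ r ^ 2` for every monic `r` of degree `j`; choosing `r` to vanish at the
zeros of `q` in `[-1, 1]` gives `P (q ≠ 0) ≥ (D_j / D_{j-1}) / 4 ^ j`. With `ρ` the smallest ratio,
capped at 1, this gives `β = (ρ / 4) ^ K`, while the sample size hypothesis gives `d ^ (24 K) < N ρ
^ (6 K)`. For `d ≥ 2` the power of `d` absorbs both the dimension and `4 ^ K`. For `d = 1` it is 1,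
and the decay of the Hankel ratios on `[-1, 1]` replaces it. -/

namespace PolyNet

/-! ### Binomial tails -/

/-- The probability that a binomial variable with parameters `n` and `β` is smaller than `D`. -/
noncomputable def binomTail (β : ℝ) : ℕ → ℕ → ℝ
  | 0, _ => 0
  | _ + 1, 0 => 1
  | D + 1, n + 1 => (1 - β) * binomTail β (D + 1) n + β * binomTail β D n

theorem binomTail_nonneg {β : ℝ} (h0 : 0 ≤ β) (h1 : β ≤ 1) (D n : ℕ) : 0 ≤ binomTail β D n := by
  induction n generalizing D with
  | zero => cases D <;> simp [binomTail]
  | succ n ih =>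
    cases D with
    | zero => simp [binomTail]
    | succ D =>
      rw [binomTail]
      exact add_nonneg (mul_nonneg (by linarith) (ih _)) (mul_nonneg h0 (ih _))

/-- Needed because the success probability of a step is only bounded below by `β`: monotonicity in
`D` makes `β` the worst case. -/
theorem binomTail_le_succ {β : ℝ} (h0 : 0 ≤ β) (h1 : β ≤ 1) (D n : ℕ) :
    binomTail β D n ≤ binomTail β (D + 1) n := by
  induction n generalizing D with
  | zero => cases D <;> simp [binomTail]
  | succ n ih =>
    cases D with
    | zero => simpa [binomTail] using binomTail_nonneg h0 h1 1 (n + 1)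
    | succ D =>
      rw [binomTail, binomTail]
      exact add_le_add (mul_le_mul_of_nonneg_left (ih _) (by linarith))
        (mul_le_mul_of_nonneg_left (ih _) h0)

/-- Markov's inequality for `2 ^ (-B)` with `B` binomial: its mean is `(1 - β / 2) ^ n`, and `B < D`
means `2 ^ (-B) ≥ 2 ^ (1 - D)`, whence the factor 2 on the left. The recursion for the bound closes
with equality. -/
theorem two_mul_binomTail_le {β : ℝ} (h0 : 0 ≤ β) (h1 : β ≤ 1) (D n : ℕ) :
    2 * binomTail β D n ≤ 2 ^ D * (1 - β / 2) ^ n := by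
  have hb : 0 ≤ 1 - β / 2 := by linarith
  induction n generalizing D with
  | zero =>
    cases D with
    | zero => simp [binomTail]
    | succ D =>
      have : (1 : ℝ) ≤ 2 ^ D := one_le_pow₀ (by norm_num)
      simp only [binomTail, pow_succ, pow_zero]
      linarith
  | succ n ih =>
    cases D with
    | zero => simp only [binomTail, mul_zero]; positivity
    | succ D =>
      rw [binomTail]
      calc 2 * ((1 - β) * binomTail β (D + 1) n + β * binomTail β D n)
          = (1 - β) * (2 * binomTail β (D + 1) n) + β * (2 * binomTail β D n) := by ring
        _ ≤ (1 - β) * (2 ^ (D + 1) * (1 - β / 2) ^ n) + β * (2 ^ D * (1 - β / 2) ^ n) :=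
            add_le_add (mul_le_mul_of_nonneg_left (ih _) (by linarith))
              (mul_le_mul_of_nonneg_left (ih _) h0)
        _ = 2 ^ (D + 1) * (1 - β / 2) ^ (n + 1) := by ring

theorem binomTail_one_eq_zero {D n : ℕ} (h : D ≤ n) : binomTail 1 D n = 0 := by
  induction n generalizing D with
  | zero => obtain rfl : D = 0 := by omega
            rfl
  | succ n ih =>
    cases D with
    | zero => rfl
    | succ D => simp [binomTail, ih (show D ≤ n by omega)]

/-! ### Degenerate samples and the dimension-drop argument -/

section Design

variable {E V : Type*} [MeasurableSpace E] [AddCommGroup V] [Module ℝ V] [FiniteDimensional ℝ V]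

/-- The samples of size `n` on which some nonzero element of `W` vanishes, where `ev` evaluates the
elements of the ambient space at points. -/
def degenerate (ev : V →ₗ[ℝ] E → ℝ) (W : Submodule ℝ V) (n : ℕ) : Set (Fin n → E) :=
  {x | ∃ p ∈ W, p ≠ 0 ∧ ∀ i, ev p (x i) = 0}

/-- In a basis of `W`, degeneracy says that the evaluation matrix has a kernel, that is, that its
Gram determinant, a measurable function of the sample, is zero. -/
theorem measurableSet_degenerate {ev : V →ₗ[ℝ] E → ℝ} (hev : ∀ p, Measurable (ev p))
    (W : Submodule ℝ V) (n : ℕ) : MeasurableSet (degenerate ev W n) := by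
  let b := Module.finBasis ℝ W
  let M : (Fin n → E) → Matrix (Fin n) (Fin (Module.finrank ℝ W)) ℝ :=
    fun x => Matrix.of fun i j => ev (b j) (x i)
  have hM : ∀ x (v : Fin (Module.finrank ℝ W) → ℝ) i,
      (M x).mulVec v i = ev ((b.equivFun.symm v : W) : V) (x i) := by
    intro x v i
    rw [Module.Basis.equivFun_symm_apply]
    simp [M, Matrix.mulVec, dotProduct, Finset.sum_apply, mul_comm]
  have hset : degenerate ev W n = {x | ((M x).transpose * M x).det = 0} := by
    ext x
    rw [Set.mem_ofPred_eq, ← Matrix.exists_mulVec_eq_zero_iff]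
    constructor
    · rintro ⟨p, hp, hp0, hx⟩
      refine ⟨b.equivFun ⟨p, hp⟩, ?_, ?_⟩
      · exact fun h => hp0 (congrArg Subtype.val (b.equivFun.map_eq_zero_iff.1 h))
      · rw [← Matrix.mulVec_mulVec]
        have : (M x).mulVec (b.equivFun ⟨p, hp⟩) = 0 := by
          ext i
          rw [hM]
          simpa using hx i
        rw [this, Matrix.mulVec_zero]
    · rintro ⟨v, hv, h⟩
      have h2 : (M x).mulVec v = 0 := by
        have := Matrix.conjTranspose_mul_self_mulVec_eq_zero (M x) v
        rw [Matrix.conjTranspose_eq_transpose_of_trivial] at this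
        exact this.1 h
      refine ⟨(b.equivFun.symm v : W), Subtype.coe_prop _, ?_, fun i => ?_⟩
      · exact fun h => hv (b.equivFun.symm.map_eq_zero_iff.1 (Subtype.ext h))
      · rw [← hM, h2]; rfl
  rw [hset]
  have : Measurable fun x => ((M x).transpose * M x).det := by
    simp only [Matrix.det_apply, Matrix.mul_apply, Matrix.transpose_apply, M, Matrix.of_apply]
    have := fun (j : Fin (Module.finrank ℝ W)) (i : Fin n) =>
      (hev (b j)).comp (measurable_pi_apply (X := fun _ => E) i)
    simp only [Function.comp_def] at this
    refine Finset.measurable_sum _ fun s _ => Measurable.const_smul ?_ _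
    refine Finset.measurable_prod _ fun j _ => Finset.measurable_sum _ fun i _ => ?_
    exact (this _ i).mul (this _ i)
  exact this (measurableSet_singleton 0)

variable {ν : Measure E} [IsProbabilityMeasure ν]

/-- Condition on the first point `x`: the remaining points must be degenerate for the elements of
`W` vanishing at `x`. That subspace is strictly smaller whenever `p` is nonzero at `x`. -/
theorem measure_degenerate_succ_le {ev : V →ₗ[ℝ] E → ℝ} (hev : ∀ p, Measurable (ev p))
    {n : ℕ} {W : Submodule ℝ V} {p : V} (hp : p ∈ W) {A B : ℝ}
    (hA : ∀ W' ≤ W, (Measure.pi fun _ : Fin n => ν).real (degenerate ev W' n) ≤ A)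
    (hB : ∀ W' < W, (Measure.pi fun _ : Fin n => ν).real (degenerate ev W' n) ≤ B) :
    (Measure.pi fun _ : Fin (n + 1) => ν).real (degenerate ev W (n + 1))
      ≤ ν.real {x | ev p x = 0} * A + (1 - ν.real {x | ev p x = 0}) * B := by
  have hZ : MeasurableSet {x | ev p x = 0} := hev p (measurableSet_singleton 0)
  have hmp := (measurePreserving_piFinSuccAbove (fun _ : Fin (n + 1) => ν) 0).symm
  have hmeas := measurableSet_degenerate hev W (n + 1)
  set S := (MeasurableEquiv.piFinSuccAbove (fun _ : Fin (n + 1) => E) 0).symm ⁻¹'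
    degenerate ev W (n + 1) with hS
  have hSm : MeasurableSet S := hmp.measurable hmeas
  have hslice : ∀ x, (Prod.mk x ⁻¹' S : Set (Fin n → E)) =
      degenerate ev (W ⊓ LinearMap.ker ((LinearMap.proj x).comp ev)) n := by
    intro x
    ext y
    simp only [hS, Set.mem_preimage, degenerate, Set.mem_ofPred_eq, Submodule.mem_inf,
      LinearMap.mem_ker, LinearMap.comp_apply, LinearMap.proj_apply, Fin.forall_fin_succ,
      MeasurableEquiv.piFinSuccAbove_symm_apply, Fin.insertNthEquiv, Equiv.coe_fn_mk,
      Fin.insertNth_zero, Fin.cons_zero, Fin.cons_succ]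
    constructor
    · rintro ⟨q, h1, h2, h3, h4⟩
      exact ⟨q, ⟨h1, h3⟩, h2, h4⟩
    · rintro ⟨q, ⟨h1, h3⟩, h2, h4⟩
      exact ⟨q, h1, h2, h3, h4⟩
  have h1 : (Measure.pi fun _ : Fin (n + 1) => ν).real (degenerate ev W (n + 1))
      = (ν.prod (Measure.pi fun _ : Fin n => ν)).real S := by
    rw [measureReal_def, measureReal_def, ← hmp.measure_preimage_equiv]
  have hint : ∫ x, (Measure.pi fun _ : Fin n => ν).real (Prod.mk x ⁻¹' S) ∂ν
      ≤ ∫ x, ({x | ev p x = 0}.indicator (fun _ => A) x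
        + {x | ev p x = 0}ᶜ.indicator (fun _ => B) x) ∂ν := by
    apply integral_mono_of_nonneg
    · exact Filter.Eventually.of_forall fun x => measureReal_nonneg
    · exact ((integrable_const A).indicator hZ).add ((integrable_const B).indicator hZ.compl)
    · refine Filter.Eventually.of_forall fun x => ?_
      simp only [hslice]
      by_cases hx : ev p x = 0
      · rw [Set.indicator_of_mem (by exact hx), Set.indicator_of_notMem (by simpa using hx),
          add_zero]
        exact hA _ inf_le_left
      · rw [Set.indicator_of_notMem (by exact hx), Set.indicator_of_mem (by simpa using hx),
          zero_add]
        refine hB _ (lt_of_le_of_ne inf_le_left fun h => hx ?_)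
        rw [← h] at hp
        simpa using hp.2
  rw [h1, ← integral_indicator_one hSm, integral_prod _ ((integrable_const _).indicator hSm)]
  have h2 : ∀ x, ∫ y, S.indicator 1 (x, y) ∂(Measure.pi fun _ : Fin n => ν)
      = (Measure.pi fun _ : Fin n => ν).real (Prod.mk x ⁻¹' S) := by
    intro x
    rw [← integral_indicator_one (measurable_prodMk_left hSm)]
    rfl
  simp only [h2]
  refine hint.trans (le_of_eq ?_)
  rw [integral_add ((integrable_const A).indicator hZ) ((integrable_const B).indicator hZ.compl),
    integral_indicator_const _ hZ, integral_indicator_const _ hZ.compl, probReal_compl_eq_one_sub hZ]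
  simp

/-- Each new point lowers the dimension with probability at least `β`, whatever subspace is left, so
the binomial recursion dominates. The zero subspace is treated apart since it offers no test element
`p`; it is never degenerate. -/
theorem measure_degenerate_le_binomTail {ev : V →ₗ[ℝ] E → ℝ} (hev : ∀ p, Measurable (ev p))
    {β : ℝ} (h0 : 0 ≤ β) (h1 : β ≤ 1) (hν : ∀ p, p ≠ 0 → ν.real {x | ev p x = 0} ≤ 1 - β)
    {D n : ℕ} {W : Submodule ℝ V} (hD : Module.finrank ℝ W ≤ D) :
    (Measure.pi fun _ : Fin n => ν).real (degenerate ev W n) ≤ binomTail β D n := by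
  have hbot : ∀ n, degenerate ev (⊥ : Submodule ℝ V) n = ∅ := by
    intro n
    ext x
    simp only [degenerate, Submodule.mem_bot, Set.mem_ofPred_eq, Set.mem_empty_iff_false, iff_false]
    rintro ⟨p, hp, hp', -⟩
    exact hp' hp
  by_cases hW : W = ⊥
  · rw [hW, hbot, measureReal_empty]
    exact binomTail_nonneg h0 h1 _ _
  induction n generalizing D W with
  | zero =>
    obtain ⟨D, rfl⟩ : ∃ D', D = D' + 1 := ⟨D - 1, by
      have := (Submodule.one_le_finrank_iff (S := W)).2 hW
      omega⟩
    exact measureReal_le_one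
  | succ n ih =>
    obtain ⟨D, rfl⟩ : ∃ D', D = D' + 1 := ⟨D - 1, by
      have := (Submodule.one_le_finrank_iff (S := W)).2 hW
      omega⟩
    have ih' : ∀ {D : ℕ} {W : Submodule ℝ V}, Module.finrank ℝ W ≤ D →
        (Measure.pi fun _ : Fin n => ν).real (degenerate ev W n) ≤ binomTail β D n := by
      intro D W hD
      by_cases hW : W = ⊥
      · rw [hW, hbot, measureReal_empty]
        exact binomTail_nonneg h0 h1 _ _
      · exact ih hD hW
    obtain ⟨p, hpW, hp⟩ := Submodule.exists_mem_ne_zero_of_ne_bot hW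
    refine (measure_degenerate_succ_le hev hpW (A := binomTail β (D + 1) n)
      (B := binomTail β D n) ?_ ?_).trans ?_
    · exact fun W' h => ih' ((Submodule.finrank_mono h).trans hD)
    · exact fun W' h => ih' (by have := Submodule.finrank_lt_finrank_of_lt h; omega)
    · rw [binomTail]
      nlinarith [hν p hp, binomTail_le_succ h0 h1 D n]

/-- If some element of `W` vanishes nowhere, the first sample already lowers the dimension. -/
theorem measure_degenerate_succ_le_binomTail {ev : V →ₗ[ℝ] E → ℝ} (hev : ∀ p, Measurable (ev p))
    {β : ℝ} (h0 : 0 ≤ β) (h1 : β ≤ 1) (hν : ∀ p, p ≠ 0 → ν.real {x | ev p x = 0} ≤ 1 - β)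
    {D n : ℕ} {W : Submodule ℝ V} (hD : Module.finrank ℝ W ≤ D + 1) {p : V} (hpW : p ∈ W)
    (hp : ∀ x, ev p x ≠ 0) :
    (Measure.pi fun _ : Fin (n + 1) => ν).real (degenerate ev W (n + 1)) ≤ binomTail β D n := by
  refine (measure_degenerate_succ_le hev hpW (A := 1) (B := binomTail β D n) ?_ ?_).trans ?_
  · exact fun _ _ => measureReal_le_one
  · exact fun W' h => measure_degenerate_le_binomTail hev h0 h1 hν
      (by have := Submodule.finrank_lt_finrank_of_lt h; omega)
  · simp [hp]

end Design

/-! ### Probability that a polynomial does not vanish -/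

theorem measurable_eval_mvPolynomial {ι : Type*} (p : MvPolynomial ι ℝ) :
    Measurable fun x : ι → ℝ => MvPolynomial.eval x p := by
  induction p using MvPolynomial.induction_on with
  | C a => simp
  | add p q hp hq => simp only [map_add]; exact hp.add hq
  | mul_X p i hp =>
    simp only [map_mul, MvPolynomial.eval_X]
    exact hp.mul (measurable_pi_apply i)

/-- If univariate polynomials of degree `j ≤ s` are nonzero with probability at least `γ ^ j` under
`P`, then polynomials of total degree at most `M` and degree at most `s` in each variable are nonzero
with probability at least `γ ^ M` under the product measure. -/
theorem pow_le_measure_eval_ne_zero {P : Measure ℝ} [IsProbabilityMeasure P] {γ : ℝ} (h0 : 0 ≤ γ)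
    (h1 : γ ≤ 1) {s : ℕ∞}
    (hγ : ∀ q : Polynomial ℝ, q ≠ 0 → (q.natDegree : ℕ∞) ≤ s →
      γ ^ q.natDegree ≤ P.real {x | q.eval x ≠ 0})
    {d M : ℕ} {p : MvPolynomial (Fin d) ℝ} (hp : p ≠ 0) (hM : p.totalDegree ≤ M)
    (hs : ∀ i, (p.degreeOf i : ℕ∞) ≤ s) :
    γ ^ M ≤ (Measure.pi fun _ : Fin d => P).real {x | MvPolynomial.eval x p ≠ 0} := by
  refine (pow_le_pow_of_le_one h0 h1 hM).trans ?_
  clear hM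
  induction d with
  | zero =>
    obtain ⟨c, rfl⟩ := MvPolynomial.C_surjective (Fin 0) p
    have hc : c ≠ 0 := by rintro rfl; simp at hp
    simp [hc]
  | succ d ih =>
    -- Schwartz–Zippel: view `p` as a polynomial in the first variable. Where its leading
    -- coefficient `q` is nonzero the degree `j` survives specialization, and the exponents add up
    -- because `deg q + j ≤ deg p`.
    set Q := MvPolynomial.finSuccEquiv ℝ d p with hQ
    have hQ0 : Q ≠ 0 := by simpa [hQ] using hp
    set j := Q.natDegree with hj
    set q := Q.leadingCoeff with hq
    have hq0 : q ≠ 0 := Polynomial.leadingCoeff_ne_zero.2 hQ0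
    have hdeg : q.totalDegree + j ≤ p.totalDegree :=
      MvPolynomial.totalDegree_coeff_finSuccEquiv_add_le p j hq0
    have hjs : (j : ℕ∞) ≤ s := by
      rw [hj, hQ, MvPolynomial.natDegree_finSuccEquiv]
      exact hs 0
    have hqs : ∀ i, (q.degreeOf i : ℕ∞) ≤ s := fun i =>
      le_trans (by exact_mod_cast MvPolynomial.degreeOf_coeff_finSuccEquiv p i j) (hs i.succ)
    have IH := ih hq0 hqs
    have hmp := (measurePreserving_piFinSuccAbove (fun _ : Fin (d + 1) => P) 0).symm
    have hpm : MeasurableSet {x | MvPolynomial.eval x p ≠ 0} :=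
      (measurable_eval_mvPolynomial p (measurableSet_singleton 0)).compl
    have hqm : MeasurableSet {y | MvPolynomial.eval y q ≠ 0} :=
      (measurable_eval_mvPolynomial q (measurableSet_singleton 0)).compl
    set S := (MeasurableEquiv.piFinSuccAbove (fun _ : Fin (d + 1) => ℝ) 0).symm ⁻¹'
      {x | MvPolynomial.eval x p ≠ 0} with hS
    have hSm : MeasurableSet S := hmp.measurable hpm
    have hslice : ∀ y, ((fun x => (x, y)) ⁻¹' S) =
        {x | (Q.map (MvPolynomial.eval y)).eval x ≠ 0} := by
      intro y
      ext x
      simp only [hS, Set.mem_preimage, Set.mem_ofPred_eq,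
        MeasurableEquiv.piFinSuccAbove_symm_apply, Fin.insertNthEquiv, Equiv.coe_fn_mk,
        Fin.insertNth_zero, hQ]
      rw [← MvPolynomial.eval_eq_eval_mv_eval']
      rfl
    have h2 : (Measure.pi fun _ : Fin (d + 1) => P).real {x | MvPolynomial.eval x p ≠ 0}
        = (P.prod (Measure.pi fun _ : Fin d => P)).real S := by
      rw [measureReal_def, measureReal_def, ← hmp.measure_preimage_equiv]
    have h3 : ∀ y, ∫ x, S.indicator 1 (x, y) ∂P = P.real ((fun x => (x, y)) ⁻¹' S) := by
      intro y
      rw [← integral_indicator_one (measurable_prodMk_right hSm)]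
      rfl
    have hint : Integrable (fun y => P.real ((fun x => (x, y)) ⁻¹' S))
        (Measure.pi fun _ : Fin d => P) := by
      simp only [← h3]
      exact ((integrable_const (1 : ℝ)).indicator hSm).integral_prod_right
    rw [h2, ← integral_indicator_one hSm, integral_prod_symm _ ((integrable_const _).indicator hSm)]
    simp only [h3]
    calc γ ^ p.totalDegree ≤ γ ^ (q.totalDegree + j) := pow_le_pow_of_le_one h0 h1 hdeg
      _ = γ ^ q.totalDegree * γ ^ j := pow_add _ _ _
      _ ≤ (Measure.pi fun _ : Fin d => P).real {y | MvPolynomial.eval y q ≠ 0} * γ ^ j := by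
          gcongr
      _ = ∫ y, {y | MvPolynomial.eval y q ≠ 0}.indicator (fun _ => γ ^ j) y
            ∂(Measure.pi fun _ : Fin d => P) := by
          rw [integral_indicator_const _ hqm, smul_eq_mul]
      _ ≤ _ := by
          refine integral_mono ((integrable_const _).indicator hqm) hint fun y => ?_
          by_cases hy : MvPolynomial.eval y q = 0
          · simp [hy]
          · rw [Set.indicator_of_mem (by exact hy)]
            simp only [hslice]
            have hnd : (Q.map (MvPolynomial.eval y)).natDegree = j :=
              Polynomial.natDegree_map_of_leadingCoeff_ne_zero _ hy
            have := hγ (Q.map (MvPolynomial.eval y))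
              (fun h => hy (by
                have := congrArg (fun r => Polynomial.coeff r j) h
                rwa [Polynomial.coeff_map, Polynomial.coeff_zero] at this)) (by rwa [hnd])
            rwa [hnd] at this

/-- The same induction with null sets: off the zeros of the leading coefficient each slice is
finite, hence null for a measure without atoms. -/
theorem measure_pi_eval_eq_zero {P : Measure ℝ} [SigmaFinite P] [NullSingletonClass P] {d : ℕ}
    {p : MvPolynomial (Fin d) ℝ} (hp : p ≠ 0) :
    (Measure.pi fun _ : Fin d => P) {x | MvPolynomial.eval x p = 0} = 0 := by
  induction d with
  | zero =>
    obtain ⟨c, rfl⟩ := MvPolynomial.C_surjective (Fin 0) p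
    have hc : c ≠ 0 := by rintro rfl; simp at hp
    simp [hc]
  | succ d ih =>
    set Q := MvPolynomial.finSuccEquiv ℝ d p with hQ
    have hQ0 : Q ≠ 0 := by simpa [hQ] using hp
    have hmp := (measurePreserving_piFinSuccAbove (fun _ : Fin (d + 1) => P) 0).symm
    have hpm : MeasurableSet {x | MvPolynomial.eval x p = 0} :=
      measurable_eval_mvPolynomial p (measurableSet_singleton 0)
    rw [← hmp.measure_preimage_equiv, Measure.prod_apply_symm (hmp.measurable hpm),
      ← lintegral_zero]
    refine lintegral_congr_ae ?_
    filter_upwards [measure_eq_zero_iff_ae_notMem.1 (ih (Polynomial.leadingCoeff_ne_zero.2 hQ0))]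
      with y hy
    have hy' : MvPolynomial.eval y Q.leadingCoeff ≠ 0 := hy
    have hmap : Q.map (MvPolynomial.eval y) ≠ 0 := fun h => hy' (by
      have := congrArg (fun r => Polynomial.coeff r Q.natDegree) h
      rwa [Polynomial.coeff_map, Polynomial.coeff_zero] at this)
    refine measure_mono_null ?_ ((Polynomial.finite_setOfPred_isRoot hmap).measure_zero P)
    intro x hx
    simp only [Set.mem_preimage, Set.mem_ofPred_eq,
      MeasurableEquiv.piFinSuccAbove_symm_apply, Fin.insertNthEquiv, Equiv.coe_fn_mk,
      Fin.insertNth_zero] at hx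
    rw [Set.mem_ofPred_eq, Polynomial.IsRoot, hQ, ← MvPolynomial.eval_eq_eval_mv_eval']
    exact hx

/-! ### Hankel determinants as extremal values -/

open Matrix in
/-- Fischer's inequality for the last row and column, in terms of the quadratic form. -/
theorem det_le_det_submatrix_mul {n : ℕ} {H : Matrix (Fin (n + 1)) (Fin (n + 1)) ℝ}
    (hH : H.IsHermitian) (hA : (H.submatrix Fin.castSucc Fin.castSucc).PosDef)
    {v : Fin (n + 1) → ℝ} (hv : v (Fin.last n) = 1) :
    H.det ≤ (H.submatrix Fin.castSucc Fin.castSucc).det * (v ⬝ᵥ H *ᵥ v) := by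
  let e : Fin n ⊕ Fin 1 ≃ Fin (n + 1) := finSumFinEquiv
  set A := H.submatrix Fin.castSucc Fin.castSucc with hAdef
  set B : Matrix (Fin n) (Fin 1) ℝ := (H.submatrix e e).toBlocks₁₂ with hB
  set D : Matrix (Fin 1) (Fin 1) ℝ := (H.submatrix e e).toBlocks₂₂ with hD
  have hsym : ∀ i j, H i j = H j i := fun i j => by simpa using (hH.apply i j).symm
  have hblocks : H.submatrix e e = fromBlocks A B Bᴴ D := by
    rw [← fromBlocks_toBlocks (H.submatrix e e)]
    congr 1
    ext i j
    simp [hB, toBlocks₁₂, toBlocks₂₁, hsym (e (Sum.inr i))]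
  have hunit : IsUnit A := hA.isUnit
  let _ : Invertible A := hunit.invertible
  have hdet : H.det = A.det * (D - Bᴴ * A⁻¹ * B) 0 0 := by
    rw [← det_submatrix_equiv_self e H, hblocks, det_fromBlocks₁₁, det_fin_one, invOf_eq_nonsing_inv]
  have hform : v ⬝ᵥ H *ᵥ v = (v ∘ e) ⬝ᵥ (H.submatrix e e) *ᵥ (v ∘ e) := by
    rw [submatrix_mulVec_equiv, Function.comp_assoc, Equiv.self_comp_symm, Function.comp_id,
      comp_equiv_dotProduct_comp_equiv]
  rw [hdet]
  refine mul_le_mul_of_nonneg_left ?_ hA.det_pos.le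
  have hsplit : v ∘ e = Sum.elim (v ∘ e ∘ Sum.inl) (fun _ : Fin 1 => (1 : ℝ)) := by
    ext i
    rcases i with i | i
    · rfl
    · obtain rfl : i = 0 := Subsingleton.elim _ _
      exact hv
  -- Completing the square writes the form as a nonnegative square for `A` plus the Schur
  -- complement, which is exactly `det H / det A`.
  have hschur := schur_complement_eq₁₁ B D (v ∘ e ∘ Sum.inl) (fun _ : Fin 1 => (1 : ℝ)) hA.1
  rw [star_trivial, ← hsplit, ← hblocks, ← dotProduct_mulVec] at hschur
  rw [hform, hschur, ← dotProduct_mulVec, ← dotProduct_mulVec]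
  have hnn := hA.posSemidef.dotProduct_mulVec_nonneg
    (v ∘ e ∘ Sum.inl + (A⁻¹ * B) *ᵥ fun _ => (1 : ℝ))
  refine le_trans (le_of_eq ?_) (le_add_of_nonneg_left hnn)
  simp [dotProduct, mulVec]

section Moments

variable {P : Measure ℝ}

theorem IsAdmissible.ae_mem_support (_hP : IsAdmissible P) : ∀ᵐ x ∂P, x ∈ P.support :=
  Measure.support_mem_ae

theorem IsAdmissible.ae_abs_le_one (hP : IsAdmissible P) : ∀ᵐ x ∂P, |x| ≤ 1 := by
  filter_upwards [hP.ae_mem_support] with x hx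
  exact abs_le.2 (hP.support_subset hx)

theorem IsAdmissible.integrable_of_continuous (hP : IsAdmissible P) {g : ℝ → ℝ}
    (hg : Continuous g) : Integrable g P := by
  have := hP.isProbabilityMeasure
  obtain ⟨C, hC⟩ := (isCompact_Icc (a := (-1 : ℝ)) (b := 1)).exists_bound_of_continuousOn
    hg.continuousOn
  refine Integrable.of_bound hg.aestronglyMeasurable C ?_
  filter_upwards [hP.ae_abs_le_one] with x hx
  exact hC x (abs_le.1 hx)

theorem IsAdmissible.one_lt_encard_support (hP : IsAdmissible P) : 1 < P.support.encard := by
  have := hP.isProbabilityMeasure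
  by_contra! h
  rcases (Set.encard_le_one_iff_eq).1 h with h | ⟨x, h⟩
  · exact IsProbabilityMeasure.ne_zero P (Measure.support_eq_empty_iff.1 h)
  · refine hP.nonconstant x ?_
    have hae := hP.ae_mem_support
    rw [h] at hae
    have h1 : P.map (fun y => y) = P.map (fun _ => x) := Measure.map_congr hae
    rw [Measure.map_id', Measure.map_const, measure_univ, one_smul] at h1
    exact h1

open Matrix in
theorem IsAdmissible.hankel_quadForm (hP : IsAdmissible P) {n : ℕ} (v : Fin (n + 1) → ℝ) :
    v ⬝ᵥ (Matrix.of fun i j : Fin (n + 1) => rawMoment P (i + j)) *ᵥ v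
      = ∫ x, (∑ i, v i * x ^ (i : ℕ)) ^ 2 ∂P := by
  have h : ∀ x : ℝ, (∑ i, v i * x ^ (i : ℕ)) ^ 2
      = ∑ i, ∑ j, v i * v j * x ^ ((i : ℕ) + j) := by
    intro x
    rw [sq, Finset.sum_mul_sum]
    refine Finset.sum_congr rfl fun i _ => Finset.sum_congr rfl fun j _ => ?_
    ring
  simp only [h]
  rw [integral_finsetSum _ fun i _ => hP.integrable_of_continuous (by fun_prop)]
  refine Finset.sum_congr rfl fun i _ => ?_
  rw [integral_finsetSum _ fun j _ => hP.integrable_of_continuous (by fun_prop), mulVec,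
    dotProduct, Finset.mul_sum]
  refine Finset.sum_congr rfl fun j _ => ?_
  rw [integral_const_mul, of_apply, rawMoment]
  ring

/-- Were the integral zero, the open set `q ≠ 0` would be null, so the support would lie among the
roots of `q`, which are too few. -/
theorem IsAdmissible.integral_sq_eval_pos (hP : IsAdmissible P) {q : Polynomial ℝ} (hq : q ≠ 0)
    (hdeg : (q.natDegree : ℕ∞) < P.support.encard) : 0 < ∫ x, q.eval x ^ 2 ∂P := by
  refine lt_of_le_of_ne (integral_nonneg fun x => sq_nonneg _) fun h => ?_
  have hz := (integral_eq_zero_iff_of_nonneg (fun x => sq_nonneg (q.eval x))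
    (hP.integrable_of_continuous (by fun_prop))).1 h.symm
  have hnull : P {x | q.eval x ≠ 0} = 0 := by
    refine (measure_eq_zero_iff_ae_notMem).2 ?_
    filter_upwards [hz] with x hx
    simpa using hx
  have hopen : IsOpen {x | q.eval x ≠ 0} := isOpen_ne_fun q.continuous continuous_const
  have hsub : P.support ⊆ (q.roots.toFinset : Set ℝ) := by
    intro x hx
    have := Measure.subset_compl_support_of_isOpen hopen hnull
    by_contra hx'
    exact this (by simpa [hq] using hx') hx
  have h1 := Set.encard_le_encard hsub
  rw [Set.encard_coe_eq_coe_finsetCard] at h1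
  have h2 : (q.roots.toFinset.card : ℕ∞) ≤ q.natDegree := by
    exact_mod_cast (Multiset.toFinset_card_le _).trans (Polynomial.card_roots' q)
  exact absurd (h1.trans h2) (not_le.2 hdeg)

theorem IsAdmissible.posDef_hankel (hP : IsAdmissible P) {n : ℕ}
    (hn : (n : ℕ∞) < P.support.encard) :
    (Matrix.of fun i j : Fin (n + 1) => rawMoment P (i + j)).PosDef := by
  refine Matrix.PosDef.of_dotProduct_mulVec_pos ?_ fun {v} hv => ?_
  · ext i j
    simp [add_comm]
  · rw [star_trivial, hP.hankel_quadForm]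
    set q : Polynomial ℝ := ∑ i : Fin (n + 1), Polynomial.monomial (i : ℕ) (v i) with hq
    have hcoeff : ∀ i : Fin (n + 1), q.coeff i = v i := by
      intro i
      simp [hq, Polynomial.coeff_monomial, Fin.val_inj]
    have hq0 : q ≠ 0 := by
      intro h
      refine hv (funext fun i => ?_)
      rw [← hcoeff, h]
      rfl
    have hdeg : q.natDegree ≤ n :=
      Polynomial.natDegree_sum_le_of_forall_le _ _ fun i _ =>
        (Polynomial.natDegree_monomial_le _).trans (Nat.lt_succ_iff.1 i.2)
    have := hP.integral_sq_eval_pos hq0 (lt_of_le_of_lt (by exact_mod_cast hdeg) hn)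
    simpa [hq, Polynomial.eval_finsetSum] using this

theorem IsAdmissible.hankelDet_pos (hP : IsAdmissible P) {n : ℕ}
    (hn : (n : ℕ∞) < P.support.encard) : 0 < hankelDet P n :=
  (hP.posDef_hankel hn).det_pos

theorem IsAdmissible.hankelRatio_zero (hP : IsAdmissible P) : hankelRatio P 0 = 1 := by
  have := hP.isProbabilityMeasure
  simp [hankelRatio, hankelDet, rawMoment]

theorem IsAdmissible.hankelRatio_pos (hP : IsAdmissible P) {n : ℕ}
    (hn : (n : ℕ∞) < P.support.encard) : 0 < hankelRatio P n := by
  cases n with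
  | zero => rw [hP.hankelRatio_zero]; exact one_pos
  | succ n =>
    exact div_pos (hP.hankelDet_pos hn)
      (hP.hankelDet_pos (lt_of_le_of_lt (by exact_mod_cast Nat.le_succ n) hn))

/-- Among monic polynomials `q` of degree `n`, the integral of `q ^ 2` is at least `D_n / D_{n-1}`. -/
theorem IsAdmissible.hankelRatio_le_integral (hP : IsAdmissible P) {q : Polynomial ℝ}
    (hq : q.Monic) (hn : (q.natDegree : ℕ∞) < P.support.encard) :
    hankelRatio P q.natDegree ≤ ∫ x, q.eval x ^ 2 ∂P := by
  have := hP.isProbabilityMeasure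
  obtain ⟨n, hdeg⟩ : ∃ n, q.natDegree = n := ⟨_, rfl⟩
  rw [hdeg] at hn ⊢
  cases n with
  | zero =>
    obtain rfl : q = 1 := hq.natDegree_eq_zero.1 hdeg
    simp [hP.hankelRatio_zero]
  | succ n =>
    have hn' : (n : ℕ∞) < P.support.encard :=
      lt_of_le_of_lt (by exact_mod_cast Nat.le_succ n) hn
    rw [hankelRatio, div_le_iff₀ (hP.hankelDet_pos hn'), mul_comm]
    have h := det_le_det_submatrix_mul (hP.posDef_hankel hn).1 (by exact hP.posDef_hankel hn')
      (v := fun i => q.coeff i) (by simpa [← hdeg] using hq.coeff_natDegree)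
    rw [hP.hankel_quadForm] at h
    refine h.trans (le_of_eq ?_)
    congr 1
    refine integral_congr_ae (Filter.Eventually.of_forall fun x => ?_)
    simp only
    rw [Polynomial.eval_eq_sum_range, hdeg, Finset.sum_range]

/-- Test the extremal property on a monic `r` of degree `j` that vanishes wherever `q` does on `[-1,
1]`. There `|r| ≤ 2 ^ j`, so `∫ r ^ 2` is at most `4 ^ j` times the probability that `q` is nonzero.
-/
theorem IsAdmissible.hankelRatio_div_le (hP : IsAdmissible P) {q : Polynomial ℝ} (hq : q ≠ 0)
    (hn : (q.natDegree : ℕ∞) < P.support.encard) :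
    hankelRatio P q.natDegree / 4 ^ q.natDegree ≤ P.real {x | q.eval x ≠ 0} := by
  have := hP.isProbabilityMeasure
  classical
  set j := q.natDegree with hj
  set Z := q.roots.toFinset.filter fun a => |a| ≤ 1 with hZ
  have hcard : Z.card ≤ j :=
    (Finset.card_filter_le _ _).trans ((Multiset.toFinset_card_le _).trans (Polynomial.card_roots' q))
  -- The power of `X` pads the degree to exactly `j` without increasing the size on `[-1, 1]`.
  set r : Polynomial ℝ := Polynomial.X ^ (j - Z.card) * ∏ a ∈ Z, (Polynomial.X - Polynomial.C a)
    with hr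
  have hmonic : (∏ a ∈ Z, (Polynomial.X - Polynomial.C a)).Monic :=
    Polynomial.monic_prod_of_monic _ _ fun a _ => Polynomial.monic_X_sub_C a
  have hrm : r.Monic := (Polynomial.monic_X_pow _).mul hmonic
  have hrdeg : r.natDegree = j := by
    rw [hr, (Polynomial.monic_X_pow _).natDegree_mul hmonic, Polynomial.natDegree_X_pow,
      Polynomial.natDegree_prod_of_monic _ _ fun a _ => Polynomial.monic_X_sub_C a]
    simp only [Polynomial.natDegree_X_sub_C, Finset.sum_const, smul_eq_mul, mul_one]
    omega
  have h1 := hP.hankelRatio_le_integral hrm (by rwa [hrdeg])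
  rw [hrdeg] at h1
  have hm : MeasurableSet {x | q.eval x ≠ 0} :=
    (isOpen_ne_fun q.continuous continuous_const).measurableSet
  rw [div_le_iff₀ (by positivity), mul_comm]
  refine h1.trans ?_
  have h2 : ∫ x, r.eval x ^ 2 ∂P ≤ ∫ x, {x | q.eval x ≠ 0}.indicator (fun _ => (4 : ℝ) ^ j) x ∂P := by
    refine integral_mono_ae (hP.integrable_of_continuous (by fun_prop))
      ((integrable_const _).indicator hm) ?_
    filter_upwards [hP.ae_abs_le_one] with x hx
    by_cases hqx : q.eval x = 0
    · have hxZ : x ∈ Z := by simp [hZ, hq, hqx, hx]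
      rw [Set.indicator_of_notMem (by simpa using hqx), hr, Polynomial.eval_mul,
        Polynomial.eval_prod, Finset.prod_eq_zero hxZ (by simp)]
      simp
    · rw [Set.indicator_of_mem (by exact hqx), hr, Polynomial.eval_mul, Polynomial.eval_prod,
        ← sq_abs, abs_mul, Finset.abs_prod]
      simp only [Polynomial.eval_pow, Polynomial.eval_X, Polynomial.eval_sub, Polynomial.eval_C,
        abs_pow]
      have h3 : ∏ a ∈ Z, |x - a| ≤ 2 ^ Z.card := by
        rw [← Finset.prod_const]
        refine Finset.prod_le_prod (fun a _ => abs_nonneg _) fun a ha => ?_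
        have := (Finset.mem_filter.1 ha).2
        rw [abs_le] at this hx ⊢
        constructor <;> linarith
      have h4 : |x| ^ (j - Z.card) ≤ 1 := pow_le_one₀ (abs_nonneg _) hx
      have h5 : (2 : ℝ) ^ Z.card ≤ 2 ^ j := pow_le_pow_right₀ (by norm_num) hcard
      have h6 : 0 ≤ ∏ a ∈ Z, |x - a| := Finset.prod_nonneg fun a _ => abs_nonneg _
      calc (|x| ^ (j - Z.card) * ∏ a ∈ Z, |x - a|) ^ 2 ≤ (1 * 2 ^ j) ^ 2 := by
            gcongr
            exact h3.trans h5
        _ = 4 ^ j := by rw [one_mul, ← pow_mul, mul_comm, pow_mul]; norm_num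
  refine h2.trans (le_of_eq ?_)
  rw [integral_indicator_const _ hm, smul_eq_mul, mul_comm]

/-- The polynomial `(x² - 1/2)^(j/2) x^(j mod 2)` is monic of degree `j` and at most `2^(-j/2)` in
absolute value on `[-1, 1]`. -/
theorem IsAdmissible.four_pow_mul_hankelRatio_le (hP : IsAdmissible P) {j : ℕ}
    (hj : (j : ℕ∞) < P.support.encard) : 4 ^ (j / 2) * hankelRatio P j ≤ 1 := by
  have := hP.isProbabilityMeasure
  set r : Polynomial ℝ :=
    (Polynomial.X ^ 2 - Polynomial.C (1 / 2)) ^ (j / 2) * Polynomial.X ^ (j % 2) with hr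
  have hm1 : (Polynomial.X ^ 2 - Polynomial.C (1 / 2 : ℝ)).Monic :=
    Polynomial.monic_X_pow_sub_C _ two_ne_zero
  have hrm : r.Monic := (hm1.pow _).mul (Polynomial.monic_X_pow _)
  have hrdeg : r.natDegree = j := by
    rw [hr, (hm1.pow _).natDegree_mul (Polynomial.monic_X_pow _), hm1.natDegree_pow,
      Polynomial.natDegree_X_pow_sub_C, Polynomial.natDegree_X_pow]
    omega
  have h1 := hP.hankelRatio_le_integral hrm (by rwa [hrdeg])
  rw [hrdeg] at h1
  have h2 : ∫ x, r.eval x ^ 2 ∂P ≤ ∫ _, ((1 : ℝ) / 4) ^ (j / 2) ∂P := by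
    refine integral_mono_ae (hP.integrable_of_continuous (by fun_prop)) (integrable_const _) ?_
    filter_upwards [hP.ae_abs_le_one] with x hx
    have hx2 : x ^ 2 ≤ 1 := by simpa using (sq_le_one_iff_abs_le_one x).2 hx
    have h3 : (x ^ 2 - 1 / 2) ^ 2 ≤ 1 / 4 := by nlinarith [sq_nonneg x]
    have h4 : (x ^ 2) ^ (j % 2) ≤ 1 := pow_le_one₀ (sq_nonneg _) hx2
    calc r.eval x ^ 2 = ((x ^ 2 - 1 / 2) ^ 2) ^ (j / 2) * (x ^ 2) ^ (j % 2) := by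
          simp only [hr, Polynomial.eval_mul, Polynomial.eval_pow, Polynomial.eval_sub,
            Polynomial.eval_X, Polynomial.eval_C]
          rw [mul_pow, ← pow_mul, ← pow_mul, ← pow_mul, ← pow_mul, mul_comm 2, mul_comm 2]
      _ ≤ (1 / 4) ^ (j / 2) * 1 := by gcongr
      _ = _ := mul_one _
  rw [integral_const, probReal_univ, one_smul] at h2
  calc (4 : ℝ) ^ (j / 2) * hankelRatio P j ≤ 4 ^ (j / 2) * (1 / 4) ^ (j / 2) := by
        gcongr
        exact h1.trans h2
    _ = 1 := by rw [← mul_pow]; norm_num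

end Moments

/-! ### Networks as polynomials -/

section Network

variable {d m : ℕ}

theorem totalDegree_aeval_le (σ : Polynomial ℝ) {h : MvPolynomial (Fin d) ℝ} {e : ℕ}
    (he : h.totalDegree ≤ e) : (Polynomial.aeval h σ).totalDegree ≤ σ.natDegree * e := by
  rw [Polynomial.aeval_eq_sum_range]
  refine MvPolynomial.totalDegree_finsetSum_le fun i hi => ?_
  refine (MvPolynomial.totalDegree_smul_le _ _).trans ((MvPolynomial.totalDegree_pow _ _).trans ?_)
  exact Nat.mul_le_mul (Nat.lt_succ_iff.1 (Finset.mem_range.1 hi)) he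

theorem exists_layer_eq_eval (σ : Polynomial ℝ) {n : ℕ} (A : Matrix (Fin m) (Fin n) ℝ)
    {h : Fin n → MvPolynomial (Fin d) ℝ} {e : ℕ} (he : ∀ j, (h j).totalDegree ≤ e) :
    ∃ H : Fin m → MvPolynomial (Fin d) ℝ, (∀ j, (H j).totalDegree ≤ σ.natDegree * e) ∧
      ∀ x, (fun j => σ.eval (A.mulVec (fun i => MvPolynomial.eval x (h i)) j))
        = fun j => MvPolynomial.eval x (H j) := by
  refine ⟨fun j => Polynomial.aeval (∑ i, MvPolynomial.C (A j i) * h i) σ, fun j => ?_, fun x => ?_⟩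
  · refine totalDegree_aeval_le σ (MvPolynomial.totalDegree_finsetSum_le fun i _ => ?_)
    rw [← MvPolynomial.smul_eq_C_mul]
    exact (MvPolynomial.totalDegree_smul_le _ _).trans (he i)
  · ext j
    have : MvPolynomial.eval x (Polynomial.aeval (∑ i, MvPolynomial.C (A j i) * h i) σ)
        = σ.eval (MvPolynomial.eval x (∑ i, MvPolynomial.C (A j i) * h i)) := by
      rw [← MvPolynomial.coe_aeval_eq_eval, RingHom.coe_coe, ← Polynomial.aeval_algHom_apply,
        Polynomial.coe_aeval_eq_eval]
    rw [this]
    simp [Matrix.mulVec, dotProduct]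

theorem exists_foldl_eq_eval (σ : Polynomial ℝ) (l : List (Matrix (Fin m) (Fin m) ℝ))
    {h : Fin m → MvPolynomial (Fin d) ℝ} {e : ℕ} (he : ∀ j, (h j).totalDegree ≤ e) :
    ∃ H : Fin m → MvPolynomial (Fin d) ℝ,
      (∀ j, (H j).totalDegree ≤ σ.natDegree ^ l.length * e) ∧
      ∀ x, l.foldl (fun h A => fun j => σ.eval (A.mulVec h j)) (fun j => MvPolynomial.eval x (h j))
        = fun j => MvPolynomial.eval x (H j) := by
  induction l generalizing h e with
  | nil => exact ⟨h, by simpa using he, fun x => rfl⟩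
  | cons A l ih =>
    obtain ⟨H, hH, hHe⟩ := exists_layer_eq_eval σ A he
    obtain ⟨G, hG, hGe⟩ := ih hH
    refine ⟨G, fun j => (hG j).trans (le_of_eq ?_), fun x => ?_⟩
    · rw [List.length_cons]
      ring
    · rw [List.foldl_cons, hHe, hGe]

/-- Linear maps keep the degree and each of the `L` activations multiplies it by at most `deg σ`,
starting from the coordinates, of degree 1. -/
theorem Weights.exists_eval_eq_eval {L : ℕ} (hL : 1 ≤ L) (w : Weights d m L) (σ : Polynomial ℝ) :
    ∃ F : MvPolynomial (Fin d) ℝ, F.totalDegree ≤ σ.natDegree ^ L ∧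
      ∀ x, w.eval (fun z => σ.eval z) x = MvPolynomial.eval x F := by
  obtain ⟨H, hH, hHe⟩ := exists_layer_eq_eval σ w.first (h := fun i => MvPolynomial.X i) (e := 1)
    fun j => (MvPolynomial.totalDegree_X j).le
  obtain ⟨G, hG, hGe⟩ := exists_foldl_eq_eval σ (List.ofFn w.rest) hH
  refine ⟨∑ i, MvPolynomial.C (w.a i) * G i, ?_, fun x => ?_⟩
  · refine MvPolynomial.totalDegree_finsetSum_le fun i _ => ?_
    rw [← MvPolynomial.smul_eq_C_mul]
    refine (MvPolynomial.totalDegree_smul_le _ _).trans ((hG i).trans (le_of_eq ?_))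
    rw [List.length_ofFn, mul_one, ← pow_succ, Nat.sub_add_cancel hL]
  · have h := hHe x
    simp only [MvPolynomial.eval_X] at h
    rw [Weights.eval, h, hGe]
    simp [dotProduct]

end Network

/-! ### Coefficient vectors, polynomials and least squares -/

section Coeffs

variable {d M : ℕ} {card : ℕ∞}

theorem coe_omega (card : ℕ∞) (t : ℕ) : (omega card t : ℕ∞) = min (card - 1) t :=
  ENat.natCast_toNat (ne_top_of_le_ne_top (ENat.natCast_ne_top t) (min_le_right _ _))

theorem le_omega_iff {a t : ℕ} : a ≤ omega card t ↔ (a : ℕ∞) ≤ card - 1 ∧ a ≤ t := by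
  rw [← Nat.cast_le (α := ℕ∞), coe_omega, le_min_iff, Nat.cast_le]

/-- The cap by `t` inside `omega` is automatic, since no entry exceeds the sum `t`; only the cap by
the cardinality restricts. -/
theorem mem_multiplicities_omega {t : ℕ} {α : Fin d → ℕ} :
    α ∈ multiplicities d (omega card t) t ↔ ∑ i, α i = t ∧ ∀ i, (α i : ℕ∞) ≤ card - 1 := by
  simp only [multiplicities, Finset.mem_filter, Finset.mem_piAntidiag, Finset.mem_univ,
    implies_true, and_true, le_omega_iff]
  refine and_congr_right fun h => forall_congr' fun i => and_iff_left ?_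
  rw [← h]
  exact Finset.single_le_sum (f := α) (fun _ _ => Nat.zero_le _) (Finset.mem_univ i)

/-- The polynomial whose coefficients are listed by `T`. -/
noncomputable def toPoly (T : Coeffs d M card) : MvPolynomial (Fin d) ℝ :=
  ∑ t : Fin (M + 1), ∑ α : multiplicities d (omega card t) t,
    MvPolynomial.monomial (Finsupp.equivFunOnFinite.symm α.1) (T t α)

theorem eval_toPoly (T : Coeffs d M card) (x : Fin d → ℝ) :
    MvPolynomial.eval x (toPoly T) = predictor T x := by
  simp only [toPoly, predictor, map_sum, MvPolynomial.eval_monomial]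
  refine Finset.sum_congr rfl fun t _ => Finset.sum_congr rfl fun α _ => ?_
  rw [mul_comm, Finsupp.prod_fintype _ _ fun i => pow_zero _]
  simp

theorem coeff_toPoly (T : Coeffs d M card) (t : Fin (M + 1))
    (α : multiplicities d (omega card t) t) :
    (toPoly T).coeff (Finsupp.equivFunOnFinite.symm α.1) = T t α := by
  classical
  have hsum : ∀ (s : Fin (M + 1)) (β : multiplicities d (omega card s) s), ∑ i, β.1 i = s :=
    fun s β => (mem_multiplicities_omega.1 β.2).1
  simp only [toPoly, MvPolynomial.coeff_sum, MvPolynomial.coeff_monomial,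
    Finsupp.equivFunOnFinite.symm.injective.eq_iff]
  rw [Finset.sum_eq_single t, Finset.sum_eq_single α]
  · simp
  · intro β _ hβ
    rw [if_neg fun h => hβ (Subtype.ext h)]
  · simp
  · intro s _ hs
    refine Finset.sum_eq_zero fun β _ => if_neg fun h => hs (Fin.ext ?_)
    rw [← hsum s β, ← hsum t α, h]
  · simp

theorem mem_of_coeff_toPoly_ne_zero {T : Coeffs d M card} {a : Fin d →₀ ℕ}
    (ha : (toPoly T).coeff a ≠ 0) : ∑ i, a i ≤ M ∧ ∀ i, (a i : ℕ∞) ≤ card - 1 := by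
  classical
  simp only [toPoly, MvPolynomial.coeff_sum, MvPolynomial.coeff_monomial] at ha
  obtain ⟨t, -, ht⟩ := Finset.exists_ne_zero_of_sum_ne_zero ha
  obtain ⟨α, -, hα⟩ := Finset.exists_ne_zero_of_sum_ne_zero ht
  have h : Finsupp.equivFunOnFinite.symm α.1 = a := by
    by_contra h
    exact hα (if_neg h)
  subst h
  have := mem_multiplicities_omega.1 α.2
  exact ⟨this.1.le.trans (Nat.lt_succ_iff.1 t.2), this.2⟩

theorem totalDegree_toPoly_le (T : Coeffs d M card) : (toPoly T).totalDegree ≤ M :=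
  Finset.sup_le fun a ha => by
    rw [Finsupp.sum_fintype _ _ fun _ => rfl]
    exact (mem_of_coeff_toPoly_ne_zero (MvPolynomial.mem_support_iff.1 ha)).1

theorem degreeOf_toPoly_le (T : Coeffs d M card) (i : Fin d) :
    (toPoly T).degreeOf i ≤ omega card M := by
  rw [MvPolynomial.degreeOf_le_iff]
  intro a ha
  have h := mem_of_coeff_toPoly_ne_zero (MvPolynomial.mem_support_iff.1 ha)
  exact le_omega_iff.2 ⟨h.2 i,
    (Finset.single_le_sum (f := a) (fun _ _ => Nat.zero_le _) (Finset.mem_univ i)).trans h.1⟩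

/-- In one variable the degree is capped by `ω` rather than `M`, so the nonvanishing bound has
exponent `ω`; the univariate estimate relies on this. -/
theorem totalDegree_toPoly_le_omega (T : Coeffs 1 M card) :
    (toPoly T).totalDegree ≤ omega card M :=
  Finset.sup_le fun a ha => by
    have h := mem_of_coeff_toPoly_ne_zero (MvPolynomial.mem_support_iff.1 ha)
    rw [Finsupp.sum_fintype _ _ fun _ => rfl, Fin.sum_univ_one]
    rw [Fin.sum_univ_one] at h
    exact le_omega_iff.2 ⟨h.2 0, h.1⟩

theorem toPoly_ne_zero {T : Coeffs d M card} (hT : T ≠ 0) : toPoly T ≠ 0 := by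
  intro h
  refine hT (funext fun t => funext fun α => ?_)
  rw [← coeff_toPoly T t α, h]
  rfl

theorem exists_toPoly_eq {F : MvPolynomial (Fin d) ℝ} (hM : F.totalDegree ≤ M)
    (hc : ∀ i, (F.degreeOf i : ℕ∞) ≤ card - 1) : ∃ T : Coeffs d M card, toPoly T = F := by
  refine ⟨fun t α => F.coeff (Finsupp.equivFunOnFinite.symm α.1), ?_⟩
  ext a
  set T : Coeffs d M card := fun t α => F.coeff (Finsupp.equivFunOnFinite.symm α.1) with hT
  by_cases ha : ∑ i, a i ≤ M ∧ ∀ i, (a i : ℕ∞) ≤ card - 1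
  · have h := coeff_toPoly T ⟨∑ i, a i, Nat.lt_succ_iff.2 ha.1⟩
      ⟨a, mem_multiplicities_omega.2 ⟨rfl, ha.2⟩⟩
    have ha' : Finsupp.equivFunOnFinite.symm a = a := Equiv.symm_apply_apply _ a
    simp only [hT, ha'] at h
    exact h
  · have h1 : (toPoly T).coeff a = 0 := by
      by_contra h
      exact ha (mem_of_coeff_toPoly_ne_zero h)
    rw [h1]
    symm
    by_contra h
    have hmem := MvPolynomial.mem_support_iff.2 h
    refine ha ⟨?_, fun i => le_trans ?_ (hc i)⟩
    · have := MvPolynomial.le_totalDegree hmem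
      rw [Finsupp.sum_fintype _ _ fun _ => rfl] at this
      exact this.trans hM
    · exact_mod_cast MvPolynomial.degreeOf_le_iff.1 le_rfl a hmem

/-- The prediction function, as a linear map of the coefficients. -/
noncomputable def predictorMap (d M : ℕ) (card : ℕ∞) : Coeffs d M card →ₗ[ℝ] (Fin d → ℝ) → ℝ where
  toFun T := predictor T
  map_add' T T' := by
    ext x
    simp [predictor, mul_add, Finset.sum_add_distrib]
  map_smul' c T := by
    ext x
    simp [predictor, Finset.mul_sum, mul_left_comm]

theorem predictorMap_apply (T : Coeffs d M card) (x : Fin d → ℝ) :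
    predictorMap d M card T x = predictor T x := rfl

theorem measurable_predictorMap (T : Coeffs d M card) : Measurable (predictorMap d M card T) := by
  have : predictorMap d M card T = fun x => MvPolynomial.eval x (toPoly T) :=
    funext fun x => (eval_toPoly T x).symm
  rw [this]
  exact measurable_eval_mvPolynomial _

theorem finrank_coeffs (d M : ℕ) (card : ℕ∞) : Module.finrank ℝ (Coeffs d M card)
    = ∑ t ∈ Finset.range (M + 1), (multiplicities d (omega card t) t).card := by
  rw [Module.finrank_pi_fintype, Finset.sum_range]
  simp

/-- Since `T` interpolates, all minimizers have loss zero. The difference of one from `T` vanishes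
at every sample, hence is zero as a coefficient vector. -/
theorem recovers_of_notMem_degenerate {N : ℕ} {X : Fin N → Fin d → ℝ} {Y : Fin N → ℝ}
    (hX : X ∉ degenerate (predictorMap d M card) ⊤ N) (T : Coeffs d M card)
    (hY : ∀ i, Y i = predictor T (X i)) {f : (Fin d → ℝ) → ℝ} {A : Set (Fin d → ℝ)}
    (hf : ∀ x ∈ A, f x = predictor T x) : Recovers X Y M card f A := by
  have hT : olsLoss X Y T = 0 := by simp [olsLoss, hY]
  have hnn : ∀ T', 0 ≤ olsLoss X Y (T' : Coeffs d M card) := fun T' =>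
    Finset.sum_nonneg fun i _ => sq_nonneg _
  refine ⟨⟨predictor T, T, fun T' => hT.le.trans (hnn T'), rfl⟩, ?_⟩
  rintro h ⟨T', hmin, rfl⟩ x hx
  have hz : olsLoss X Y T' = 0 := le_antisymm ((hmin T).trans hT.le) (hnn T')
  rw [olsLoss, Finset.sum_eq_zero_iff_of_nonneg fun i _ => sq_nonneg _] at hz
  have hTT : T' - T = 0 := by
    by_contra hne
    refine hX ⟨T' - T, Submodule.mem_top, hne, fun i => ?_⟩
    have := pow_eq_zero_iff two_ne_zero |>.1 (hz i (Finset.mem_univ i))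
    rw [map_sub, Pi.sub_apply, predictorMap_apply, predictorMap_apply, ← hY]
    linarith
  rw [sub_eq_zero.1 hTT, hf x hx]

end Coeffs

/-! ### Reduction modulo the vanishing polynomial of a finite support -/

section Reduction

variable {d : ℕ}

theorem totalDegree_toMvPolynomial_le (i : Fin d) (q : Polynomial ℝ) :
    (Polynomial.toMvPolynomial i q).totalDegree ≤ q.natDegree := by
  have := totalDegree_aeval_le q (MvPolynomial.totalDegree_X (R := ℝ) i).le
  rwa [mul_one] at this

theorem degreeOf_toMvPolynomial_le (i j : Fin d) (q : Polynomial ℝ) :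
    (Polynomial.toMvPolynomial i q).degreeOf j ≤ if j = i then q.natDegree else 0 := by
  change (Polynomial.aeval (MvPolynomial.X i) q).degreeOf j ≤ _
  rw [Polynomial.aeval_eq_sum_range]
  refine (MvPolynomial.degreeOf_sum_le _ _ _).trans (Finset.sup_le fun a ha => ?_)
  rw [MvPolynomial.smul_eq_C_mul]
  refine (MvPolynomial.degreeOf_C_mul_le _ _ _).trans ((MvPolynomial.degreeOf_pow_le _ _ _).trans ?_)
  rw [MvPolynomial.degreeOf_X]
  split_ifs
  · rw [mul_one]
    exact Nat.lt_succ_iff.1 (Finset.mem_range.1 ha)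
  · rw [mul_zero]

theorem eval_toMvPolynomial' (i : Fin d) (q : Polynomial ℝ) (x : Fin d → ℝ) :
    MvPolynomial.eval x (Polynomial.toMvPolynomial i q) = q.eval (x i) := by
  change MvPolynomial.eval x (Polynomial.aeval (MvPolynomial.X i) q) = _
  simp [Polynomial.aeval_eq_sum_range, Polynomial.eval_eq_sum_range, MvPolynomial.smul_eq_C_mul]

/-- On the grid `S ^ d` every polynomial agrees with one of degree less than `|S|` in each variable
and no larger total degree. -/
theorem exists_reduced_eq_on {S : Set ℝ} (hS : S.Nonempty) (F : MvPolynomial (Fin d) ℝ) :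
    ∃ G : MvPolynomial (Fin d) ℝ, G.totalDegree ≤ F.totalDegree ∧
      (∀ i, (G.degreeOf i : ℕ∞) ≤ S.encard - 1) ∧
      ∀ x : Fin d → ℝ, (∀ i, x i ∈ S) → MvPolynomial.eval x G = MvPolynomial.eval x F := by
  rcases S.finite_or_infinite with hfin | hinf
  swap
  · exact ⟨F, le_rfl, fun i => by simp [hinf.encard_eq], fun x _ => rfl⟩
  set s := hfin.toFinset with hs
  have hcard : S.encard = s.card := hfin.encard_eq_coe_toFinset_card
  have hpos : 0 < s.card := Finset.card_pos.2 (by simpa [hs] using hS)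
  set g : Polynomial ℝ := ∏ a ∈ s, (Polynomial.X - Polynomial.C a) with hg
  have hgm : g.Monic := Polynomial.monic_prod_of_monic _ _ fun a _ => Polynomial.monic_X_sub_C a
  have hgdeg : g.natDegree = s.card := by
    rw [hg, Polynomial.natDegree_prod_of_monic _ _ fun a _ => Polynomial.monic_X_sub_C a]
    simp
  have hg1 : g ≠ 1 := by
    intro h
    rw [h, Polynomial.natDegree_one] at hgdeg
    omega
  -- Replacing each `x_i ^ n` by its remainder modulo `g` keeps its values on `S` and bounds its
  -- degree by both `n` and `|S| - 1`. The first bound protects the total degree, the second the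
  -- degree in each variable.
  let Q : ℕ → Polynomial ℝ := fun n => Polynomial.X ^ n %ₘ g
  have hQ1 : ∀ n, (Q n).natDegree ≤ n := fun n =>
    Polynomial.natDegree_modByMonic_le_left.trans (Polynomial.natDegree_X_pow n).le
  have hQ2 : ∀ n, (Q n).natDegree ≤ s.card - 1 := fun n => by
    have := Polynomial.natDegree_modByMonic_lt (Polynomial.X ^ n) hgm hg1
    change (Polynomial.X ^ n %ₘ g).natDegree ≤ _
    omega
  have hQ3 : ∀ n, ∀ y ∈ S, (Q n).eval y = y ^ n := by
    intro n y hy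
    have hgy : g.eval y = 0 := by
      rw [hg, Polynomial.eval_prod]
      exact Finset.prod_eq_zero (hfin.mem_toFinset.2 hy) (by simp)
    have := congrArg (Polynomial.eval y) (Polynomial.modByMonic_add_div (Polynomial.X ^ n) g)
    simpa [hgy] using this
  refine ⟨∑ a ∈ F.support, F.coeff a • ∏ i, Polynomial.toMvPolynomial i (Q (a i)), ?_, ?_, ?_⟩
  · refine MvPolynomial.totalDegree_finsetSum_le fun a ha => ?_
    refine (MvPolynomial.totalDegree_smul_le _ _).trans
      ((MvPolynomial.totalDegree_finsetProd _ _).trans ?_)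
    have h := MvPolynomial.le_totalDegree ha
    rw [Finsupp.sum_fintype _ _ fun _ => rfl] at h
    exact (Finset.sum_le_sum fun i _ =>
      (totalDegree_toMvPolynomial_le i _).trans (hQ1 (a i))).trans h
  · intro j
    rw [hcard, show ((s.card : ℕ∞) - 1) = ((s.card - 1 : ℕ) : ℕ∞) by simp, Nat.cast_le]
    refine (MvPolynomial.degreeOf_sum_le _ _ _).trans (Finset.sup_le fun a ha => ?_)
    rw [MvPolynomial.smul_eq_C_mul]
    refine (MvPolynomial.degreeOf_C_mul_le _ _ _).trans
      ((MvPolynomial.degreeOf_prod_le _ _ _).trans ?_)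
    refine (Finset.sum_le_sum fun i _ => degreeOf_toMvPolynomial_le i j (Q (a i))).trans ?_
    simpa using hQ2 (a j)
  · intro x hx
    rw [MvPolynomial.eval_eq' x F, map_sum]
    refine Finset.sum_congr rfl fun a _ => ?_
    rw [MvPolynomial.smul_eval, map_prod]
    congr 1
    refine Finset.prod_congr rfl fun i _ => ?_
    rw [eval_toMvPolynomial', hQ3 _ _ (hx i)]

end Reduction

/-! ### Number of coefficients -/

section Counting

theorem multichoose_le_pow (n k : ℕ) : n.multichoose k ≤ n ^ k := by
  induction n generalizing k with
  | zero => cases k <;> simp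
  | succ n ihn =>
    induction k with
    | zero => simp
    | succ k ihk =>
      rw [Nat.multichoose_succ_succ]
      calc n.multichoose (k + 1) + (n + 1).multichoose k ≤ n ^ (k + 1) + (n + 1) ^ k :=
            add_le_add (ihn _) ihk
        _ ≤ n * (n + 1) ^ k + (n + 1) ^ k := by
            rw [pow_succ']
            gcongr
            omega
        _ = (n + 1) ^ (k + 1) := by ring

theorem card_piAntidiag_univ (d t : ℕ) :
    (Finset.piAntidiag (Finset.univ : Finset (Fin d)) t).card = d.multichoose t := by
  have h := Finset.card_finsuppAntidiag_nat_eq_choose (s := (Finset.univ : Finset (Fin d))) t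
  rw [Nat.multichoose_eq]
  simpa [Finset.finsuppAntidiag] using h

theorem card_multiplicities_le (d s t : ℕ) : (multiplicities d s t).card ≤ d.multichoose t :=
  (Finset.card_filter_le _ _).trans (card_piAntidiag_univ d t).le

theorem card_multiplicities_self (d t : ℕ) :
    (multiplicities d t t).card = (d + t - 1).choose t := by
  rw [← Nat.multichoose_eq, ← card_piAntidiag_univ, multiplicities, Finset.filter_true_of_mem]
  intro α hα i
  rw [← (Finset.mem_piAntidiag.1 hα).1]
  exact Finset.single_le_sum (f := α) (fun _ _ => Nat.zero_le _) (Finset.mem_univ i)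

theorem finrank_coeffs_le (d M : ℕ) (card : ℕ∞) :
    Module.finrank ℝ (Coeffs d M card) ≤ ∑ t ∈ Finset.range (M + 1), d.multichoose t := by
  rw [finrank_coeffs]
  exact Finset.sum_le_sum fun t _ => card_multiplicities_le _ _ _

theorem finrank_coeffs_le_one {d M : ℕ} (h : d = 0 ∨ M = 0) (card : ℕ∞) :
    Module.finrank ℝ (Coeffs d M card) ≤ 1 := by
  refine (finrank_coeffs_le d M card).trans ?_
  rcases h with rfl | rfl
  · rw [Finset.sum_range_succ']
    simp
  · simp

/-- In one variable there is at most one exponent for each `t`, and none once `t` exceeds `ω`. -/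
theorem finrank_coeffs_one_le (M : ℕ) (card : ℕ∞) :
    Module.finrank ℝ (Coeffs 1 M card) ≤ omega card M + 1 := by
  rw [finrank_coeffs]
  have h : ∀ t ∈ Finset.range (M + 1),
      (multiplicities 1 (omega card t) t).card ≤ if t ≤ omega card M then 1 else 0 := by
    intro t ht
    split_ifs with h
    · simpa using card_multiplicities_le 1 (omega card t) t
    · rw [Nat.le_zero, Finset.card_eq_zero, Finset.eq_empty_iff_forall_notMem]
      intro α hα
      obtain ⟨h1, h2⟩ := mem_multiplicities_omega.1 hα
      rw [Fin.sum_univ_one] at h1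
      exact h (le_omega_iff.2 ⟨h1 ▸ h2 0, Nat.lt_succ_iff.1 (Finset.mem_range.1 ht)⟩)
  refine (Finset.sum_le_sum h).trans ?_
  rw [← Finset.sum_filter, Finset.sum_const, smul_eq_mul, mul_one]
  refine (Finset.card_le_card (t := Finset.range (omega card M + 1)) fun t ht => ?_).trans
    (Finset.card_range _).le
  exact Finset.mem_range.2 (Nat.lt_succ_iff.2 (Finset.mem_filter.1 ht).2)

theorem finrank_coeffs_le_pow {d M : ℕ} (hd : 2 ≤ d) (hM : 1 ≤ M) (card : ℕ∞) :
    Module.finrank ℝ (Coeffs d M card) ≤ d ^ (2 * M) :=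
  calc Module.finrank ℝ (Coeffs d M card) ≤ ∑ t ∈ Finset.range (M + 1), d.multichoose t :=
        finrank_coeffs_le d M card
    _ ≤ ∑ t ∈ Finset.range (M + 1), d ^ t := Finset.sum_le_sum fun t _ => multichoose_le_pow d t
    _ ≤ d ^ (M + 1) := (Nat.geomSum_lt hd fun k hk => Finset.mem_range.1 hk).le
    _ ≤ d ^ (2 * M) := Nat.pow_le_pow_right (by omega) (by omega)

end Counting

/-! ### From the condition number to the nonvanishing probability -/

section Constants

variable {P : Measure ℝ}

theorem IsAdmissible.lt_encard_of_le_omegaP (hP : IsAdmissible P) {j K : ℕ}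
    (hj : j ≤ omegaP P K) : (j : ℕ∞) < P.support.encard := by
  have h1 := hP.one_lt_encard_support
  have h2 := (le_omega_iff.1 hj).1
  generalize P.support.encard = c at h1 h2
  induction c using ENat.recTopCoe with
  | top => exact ENat.natCast_lt_top j
  | coe c =>
    norm_cast at h1 h2 ⊢
    omega

theorem IsAdmissible.one_le_omegaP (hP : IsAdmissible P) {K : ℕ} (hK : 1 ≤ K) :
    1 ≤ omegaP P K := by
  refine le_omega_iff.2 ⟨?_, hK⟩
  have h1 := hP.one_lt_encard_support
  generalize P.support.encard = c at h1
  induction c using ENat.recTopCoe with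
  | top => simp
  | coe c =>
    norm_cast at h1 ⊢
    omega

/-- The condition number controls the smallest of the ratios `D_i / D_{i-1}`. -/
theorem IsAdmissible.exists_lt_mul_pow (hP : IsAdmissible P) {K : ℕ} {A N : ℝ} (hA : 0 ≤ A)
    (h : A * condConst P K ^ 4 < N) :
    ∃ ρ : ℝ, 0 < ρ ∧ ρ ≤ 1 ∧ (∀ j ≤ omegaP P K, ρ ≤ hankelRatio P j) ∧ A < N * ρ ^ (6 * K) := by
  set R := Finset.range (omegaP P K + 1) with hR
  have hne : R.Nonempty := Finset.nonempty_range_add_one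
  have hmem : ∀ {j}, j ∈ R ↔ j ≤ omegaP P K := fun {j} => by
    rw [hR, Finset.mem_range, Nat.lt_succ_iff]
  have hpos : ∀ j ∈ R, 0 < hankelRatio P j := fun j hj =>
    hP.hankelRatio_pos (hP.lt_encard_of_le_omegaP (hmem.1 hj))
  obtain ⟨i, hi, hmin⟩ := R.exists_min_image (hankelRatio P) hne
  refine ⟨min (hankelRatio P i) 1, lt_min (hpos i hi) one_pos, min_le_right _ _,
    fun j hj => (min_le_left _ _).trans (hmin j (hmem.2 hj)), ?_⟩
  set ρ := min (hankelRatio P i) 1 with hρ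
  have hρ0 : 0 < ρ := lt_min (hpos i hi) one_pos
  -- The lower constant is at most `s` and the upper one at least `s ^ (-2)`, so the fourth power of
  -- their quotient is at least `s ^ (-12) = ρ ^ (-6 K)`.
  set s := ρ ^ ((K : ℝ) / 2) with hs
  have hs0 : 0 < s := Real.rpow_pos_of_pos hρ0 _
  have hs2 : s ^ 2 = ρ ^ K := by
    rw [hs, ← Real.rpow_natCast, ← Real.rpow_mul hρ0.le, ← Real.rpow_natCast]
    congr 1
    push_cast
    ring
  have hlow0 : 0 < lowerConst P K := by
    refine lt_min ((Finset.lt_inf'_iff _).2 fun j hj => ?_) one_pos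
    exact Real.rpow_pos_of_pos (hpos j hj) _
  have hlow : lowerConst P K ≤ s := by
    rcases le_total (hankelRatio P i) 1 with h1 | h1
    · rw [hs, hρ, min_eq_left h1]
      exact (min_le_left _ _).trans (Finset.inf'_le _ hi)
    · rw [hs, hρ, min_eq_right h1, Real.one_rpow]
      exact min_le_right _ _
  have hden0 : 0 < min (R.inf' hne fun j => hankelRatio P j ^ K) 1 :=
    lt_min ((Finset.lt_inf'_iff _).2 fun j hj => pow_pos (hpos j hj) _) one_pos
  have hden : min (R.inf' hne fun j => hankelRatio P j ^ K) 1 ≤ ρ ^ K := by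
    rcases le_total (hankelRatio P i) 1 with h1 | h1
    · rw [hρ, min_eq_left h1]
      exact (min_le_left _ _).trans (Finset.inf'_le _ hi)
    · rw [hρ, min_eq_right h1, one_pow]
      exact min_le_right _ _
  have hup : 1 / s ^ 2 ≤ upperConst P K := by
    have h1 : 1 / s ^ 2 ≤ max (R.sup' hne fun j => hankelRatio P j ^ K) 1 /
        min (R.inf' hne fun j => hankelRatio P j ^ K) 1 := by
      rw [hs2]
      exact div_le_div₀ (zero_le_one.trans (le_max_right _ _)) (le_max_right _ _) hden0 hden
    exact h1.trans (le_mul_of_one_le_left (le_trans (by positivity) h1) (le_max_right _ _))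
  have hcond : 1 / s ^ 3 ≤ condConst P K := by
    calc 1 / s ^ 3 = 1 / s ^ 2 / s := by field_simp
      _ ≤ condConst P K := div_le_div₀ (le_trans (by positivity) hup) hup hlow0 hlow
  have hfin : A * (1 / s ^ 3) ^ 4 < N :=
    lt_of_le_of_lt (mul_le_mul_of_nonneg_left (pow_le_pow_left₀ (by positivity) hcond 4) hA) h
  have hs12 : ρ ^ (6 * K) = (s ^ 3) ^ 4 := by
    rw [mul_comm, pow_mul, ← hs2]
    ring
  rw [hs12]
  rw [one_div, inv_pow, ← div_eq_mul_inv, div_lt_iff₀ (by positivity)] at hfin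
  exact hfin

/-- Puts the univariate bound in the form `γ ^ j` that the product induction requires. For `j ≥ 1`
one has `ρ ^ j ≤ ρ`, and for `j = 0` the ratio is 1. -/
theorem IsAdmissible.pow_le_measure_eval_ne_zero (hP : IsAdmissible P) {K : ℕ} {ρ : ℝ}
    (h0 : 0 < ρ) (h1 : ρ ≤ 1) (hρ : ∀ j ≤ omegaP P K, ρ ≤ hankelRatio P j) {q : Polynomial ℝ}
    (hq : q ≠ 0) (hdeg : q.natDegree ≤ omegaP P K) :
    (ρ / 4) ^ q.natDegree ≤ P.real {x | q.eval x ≠ 0} := by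
  refine le_trans ?_ (hP.hankelRatio_div_le hq (hP.lt_encard_of_le_omegaP hdeg))
  rw [div_pow]
  gcongr
  rcases Nat.eq_zero_or_pos q.natDegree with h | h
  · rw [h, hP.hankelRatio_zero, pow_zero]
  · exact (pow_le_of_le_one h0.le h1 h.ne').trans (hρ _ hdeg)

theorem IsAdmissible.measure_predictorMap_eq_zero_le (hP : IsAdmissible P) {d K M : ℕ} {ρ : ℝ}
    (h0 : 0 < ρ) (h1 : ρ ≤ 1) (hρ : ∀ j ≤ omegaP P K, ρ ≤ hankelRatio P j)
    {T : Coeffs d K P.support.encard} (hT : T ≠ 0) (hM : (toPoly T).totalDegree ≤ M) :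
    (Measure.pi fun _ : Fin d => P).real {x | predictorMap d K P.support.encard T x = 0}
      ≤ 1 - (ρ / 4) ^ M := by
  have := hP.isProbabilityMeasure
  have h := PolyNet.pow_le_measure_eval_ne_zero (P := P) (γ := ρ / 4) (by positivity) (by linarith)
    (s := (omegaP P K : ℕ∞))
    (fun q hq hdeg => hP.pow_le_measure_eval_ne_zero h0 h1 hρ hq (by exact_mod_cast hdeg))
    (toPoly_ne_zero hT) hM (fun i => by exact_mod_cast degreeOf_toPoly_le T i)
  have hset : {x | MvPolynomial.eval x (toPoly T) ≠ 0}
      = {x | predictorMap d K P.support.encard T x = 0}ᶜ := by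
    ext x
    simp [eval_toPoly, predictorMap_apply]
  have hm : MeasurableSet {x | predictorMap d K P.support.encard T x = 0} :=
    measurable_predictorMap T (measurableSet_singleton 0)
  rw [hset, probReal_compl_eq_one_sub hm] at h
  linarith

end Constants

/-! ### Numerical estimates, with `N = y ^ 12` -/

section Numerics

/-- The tail is at most `exp (D - 1 - β n / 2)` with `n ≥ y ^ 12 / 2`. The first alternative gives
`-y ^ 10 / 16`, the source of `1 / 16`; in the second, `y - y ^ 6 / 4` is far below `-y ^ 3 / 16`
once `y ≥ 4`. -/
theorem binomTail_le_exp {β y : ℝ} (h0 : 0 ≤ β) (h1 : β ≤ 1) {D n : ℕ} (hD : 1 ≤ D) (hn : 1 ≤ n)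
    (hy : 0 < y) (hN : ((n + 1 : ℕ) : ℝ) = y ^ 12)
    (h : (D = 1 ∧ 1 ≤ 4 * β * y ^ 2) ∨ ((D : ℝ) - 1 ≤ y ∧ 1 ≤ β * y ^ 6 ∧ 4 ≤ y)) :
    binomTail β D n ≤ Real.exp (-(1 / 16) * y ^ 3) := by
  obtain ⟨D, rfl⟩ : ∃ D', D = D' + 1 := ⟨D - 1, by omega⟩
  have hb := two_mul_binomTail_le h0 h1 (D + 1) n
  have h2 : binomTail β (D + 1) n ≤ 2 ^ D * (1 - β / 2) ^ n := by
    rw [pow_succ] at hb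
    linarith
  have h3 : (2 : ℝ) ^ D ≤ Real.exp D := by
    rw [← Real.exp_one_pow]
    exact pow_le_pow_left₀ (by norm_num) (by linarith [Real.add_one_le_exp 1]) D
  have h4 : (1 - β / 2) ^ n ≤ Real.exp (-(β / 2) * n) := by
    rw [mul_comm, Real.exp_nat_mul]
    exact pow_le_pow_left₀ (by linarith) (by linarith [Real.add_one_le_exp (-(β / 2))]) n
  have hn' : (1 : ℝ) ≤ n := by exact_mod_cast hn
  push_cast at hN h
  have hn2 : y ^ 12 / 2 ≤ n := by linarith
  have hy1 : 1 ≤ y := by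
    by_contra! hlt
    have := pow_lt_one₀ hy.le hlt (show 12 ≠ 0 by norm_num)
    linarith
  have hexp : (D : ℝ) + -(β / 2) * n ≤ -(1 / 16) * y ^ 3 := by
    have h5 : β / 2 * (y ^ 12 / 2) ≤ β / 2 * n := by gcongr
    rcases h with ⟨hD', hβ⟩ | ⟨hD', hβ, hy4⟩
    · have : D = 0 := by omega
      subst this
      have h6 : y ^ 3 ≤ y ^ 10 := pow_le_pow_right₀ hy1 (by norm_num)
      have h7 : y ^ 10 * 1 ≤ y ^ 10 * (4 * β * y ^ 2) := by gcongr
      push_cast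
      linarith
    · have h6 : y ^ 6 * 1 ≤ y ^ 6 * (β * y ^ 6) := by gcongr
      have h7 : 4 ^ 3 * y ^ 3 ≤ y ^ 3 * y ^ 3 := by gcongr
      have h8 : 4 ^ 2 * y ≤ y ^ 2 * y := by gcongr
      linarith
  calc binomTail β (D + 1) n ≤ 2 ^ D * (1 - β / 2) ^ n := h2
    _ ≤ Real.exp D * Real.exp (-(β / 2) * n) := by
        have : (0 : ℝ) ≤ 1 - β / 2 := by linarith
        gcongr
    _ = Real.exp (D + -(β / 2) * n) := (Real.exp_add _ _).symm
    _ ≤ _ := Real.exp_le_exp.2 hexp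

/-- There is no power of `d` to absorb `4 ^ w`. For `w ≥ 2`, `hρ` says that `ρ` is itself small:
together with `y ρ ≥ 1` it forces `y ≥ 4 ^ (w / 2)`, and spare powers of `ρ` pay for `4 ^ w`. For `w
= 1` the loss of 4 is kept in the conclusion. -/
theorem numerics_univariate {ρ y : ℝ} (h0 : 0 < ρ) (h1 : ρ ≤ 1) (hy : 0 < y) {w K : ℕ} (hw : 1 ≤ w)
    (hwK : w ≤ K) (hρ : 4 ^ (w / 2) * ρ ≤ 1) (h : 1 < y ^ 12 * ρ ^ (6 * K)) :
    (w = 1 ∧ 1 ≤ 4 * (ρ / 4) ^ w * y ^ 2) ∨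
      ((w : ℝ) - 1 ≤ y ∧ 1 ≤ (ρ / 4) ^ w * y ^ 6 ∧ 4 ≤ y) := by
  rcases Nat.eq_or_lt_of_le hw with rfl | hw2
  · refine Or.inl ⟨rfl, ?_⟩
    have h2 : 1 < (ρ * y ^ 2) ^ 6 := by
      refine h.trans_le ?_
      calc y ^ 12 * ρ ^ (6 * K) ≤ y ^ 12 * ρ ^ 6 := by
            gcongr 1
            exact pow_le_pow_of_le_one h0.le h1 (by omega)
        _ = (ρ * y ^ 2) ^ 6 := by ring
    have h3 := (one_lt_pow_iff_of_nonneg (by positivity) (by norm_num)).1 h2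
    linarith
  · right
    obtain ⟨a, ha⟩ : ∃ a, w / 2 = a := ⟨_, rfl⟩
    rw [ha] at hρ
    have hyρ : 1 ≤ y * ρ := by
      have h2 : 1 < (y * ρ) ^ 12 := by
        rw [mul_pow]
        refine h.trans_le ?_
        gcongr 1
        exact pow_le_pow_of_le_one h0.le h1 (by omega)
      exact ((one_lt_pow_iff_of_nonneg (by positivity) (by norm_num)).1 h2).le
    have h4y : (4 : ℝ) ^ a ≤ y := by
      have : (4 : ℝ) ^ a * 1 ≤ 4 ^ a * (y * ρ) := by gcongr
      nlinarith
    refine ⟨?_, ?_, ?_⟩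
    · refine le_trans ?_ h4y
      have h5 : 2 * a < 4 ^ a := by
        have := Nat.lt_pow_self (n := 2 * a) (show 1 < 2 by norm_num)
        rwa [pow_mul] at this
      have h6 : w - 1 ≤ 4 ^ a := by omega
      have h7 : ((w - 1 : ℕ) : ℝ) ≤ ((4 ^ a : ℕ) : ℝ) := by exact_mod_cast h6
      rw [Nat.cast_sub hw] at h7
      push_cast at h7
      exact h7
    · have h2 : 1 < (y ^ 6 * ρ ^ (3 * K)) ^ 2 := by
        refine h.trans_le (le_of_eq ?_)
        rw [mul_pow, ← pow_mul, ← pow_mul]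
        congr 2
        omega
      have h3 := (one_lt_pow_iff_of_nonneg (by positivity) (by norm_num)).1 h2
      -- Here `w ≤ 3 (w / 2)` because `w ≥ 2`, so the cube of `hρ` suffices.
      have h4 : 4 ^ w * ρ ^ 3 ≤ 1 :=
        calc 4 ^ w * ρ ^ 3 ≤ 4 ^ (a * 3) * ρ ^ 3 := by
              gcongr
              · norm_num
              · omega
          _ = (4 ^ a * ρ) ^ 3 := by rw [mul_pow, pow_mul]
          _ ≤ 1 := pow_le_one₀ (by positivity) hρ
      have h5 : ρ ^ (3 * K) ≤ ρ ^ w * ρ ^ 3 := by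
        rw [← pow_add]
        exact pow_le_pow_of_le_one h0.le h1 (by omega)
      have h6 : ρ ^ 3 ≤ 1 / 4 ^ w := by
        rw [le_div_iff₀ (by positivity)]
        linarith
      calc 1 ≤ y ^ 6 * ρ ^ (3 * K) := h3.le
        _ ≤ y ^ 6 * (ρ ^ w * (1 / 4 ^ w)) := by gcongr; exact h5.trans (by gcongr)
        _ = (ρ / 4) ^ w * y ^ 6 := by rw [div_pow]; ring
    · refine le_trans ?_ h4y
      exact le_self_pow₀ (by norm_num) (by omega)

/-- With `E = d ^ (2 K) ≥ 4 ^ K` the hypothesis reads `E ^ 12 < y ^ 12 ρ ^ (6 K)`. It yields `E ≤ y`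
for the dimension and `E < y ^ 6 ρ ^ K` for the probability. -/
theorem numerics_multivariate {ρ y : ℝ} (h0 : 0 < ρ) (h1 : ρ ≤ 1) (hy : 0 < y) {d K : ℕ}
    (hd : 2 ≤ d) (hK : 1 ≤ K) (h : (d : ℝ) ^ (24 * K) < y ^ 12 * ρ ^ (6 * K)) :
    (((d ^ (2 * K) : ℕ) : ℝ) - 1 ≤ y ∧ 1 ≤ (ρ / 4) ^ K * y ^ 6 ∧ 4 ≤ y) := by
  have hd' : (2 : ℝ) ≤ d := by exact_mod_cast hd
  set E := (d : ℝ) ^ (2 * K) with hE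
  have hE12 : (d : ℝ) ^ (24 * K) = E ^ 12 := by
    rw [hE, ← pow_mul]
    congr 1
    ring
  have h4E : (4 : ℝ) ^ K ≤ E := by
    rw [hE, pow_mul]
    gcongr
    nlinarith
  have h44 : (4 : ℝ) ≤ 4 ^ K := le_self_pow₀ (by norm_num) (by omega)
  have hE1 : 1 ≤ E := by linarith
  rw [hE12] at h
  have hEy : E ≤ y := by
    refine (lt_of_pow_lt_pow_left₀ 12 hy.le (h.trans_le ?_)).le
    exact mul_le_of_le_one_right (by positivity) (pow_le_one₀ h0.le h1)
  refine ⟨?_, ?_, by linarith⟩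
  · push_cast
    linarith
  · have h2 : E < y ^ 6 * ρ ^ K := by
      refine lt_of_pow_lt_pow_left₀ 2 (by positivity) ?_
      calc E ^ 2 ≤ E ^ 12 := pow_le_pow_right₀ hE1 (by norm_num)
        _ < y ^ 12 * ρ ^ (6 * K) := h
        _ ≤ y ^ 12 * ρ ^ (K * 2) := by
            gcongr 1
            exact pow_le_pow_of_le_one h0.le h1 (by omega)
        _ = (y ^ 6 * ρ ^ K) ^ 2 := by rw [mul_pow, ← pow_mul, ← pow_mul]
    rw [div_pow, div_mul_eq_mul_div, le_div_iff₀ (by positivity)]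
    linarith

end Numerics

/-! ### Probability of a degenerate design -/

/-- With enough samples, the design of T-OLS determines the coefficients with high probability. -/
theorem IsAdmissible.measure_degenerate_le {P : Measure ℝ} (hP : IsAdmissible P) {d K N : ℕ}
    (h : (d : ℝ) ^ (24 * K) * condConst P K ^ 4 < (N : ℝ)) :
    (Measure.pi fun _ : Fin N => Measure.pi fun _ : Fin d => P).real
        (degenerate (predictorMap d K P.support.encard) ⊤ N)
      ≤ Real.exp (-(1 / 16) * (N : ℝ) ^ (1 / 4 : ℝ)) := by
  have := hP.isProbabilityMeasure
  obtain ⟨ρ, h0, h1, hρ, hN⟩ := hP.exists_lt_mul_pow (by positivity) h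
  have hNpos : 0 < N := by
    have : (0 : ℝ) < N := lt_of_le_of_lt (by positivity) h
    exact_mod_cast this
  obtain ⟨n, rfl⟩ : ∃ n, N = n + 1 := ⟨N - 1, by omega⟩
  -- The constant polynomial 1 vanishes nowhere, so the first sample surely removes one dimension.
  obtain ⟨T, hT⟩ := exists_toPoly_eq (M := K) (card := P.support.encard)
    (F := (1 : MvPolynomial (Fin d) ℝ)) (by simp)
    (fun i => by rw [← MvPolynomial.C_1, MvPolynomial.degreeOf_C]; simp)
  have hTne : ∀ x, predictorMap d K P.support.encard T x ≠ 0 := fun x => by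
    rw [predictorMap_apply, ← eval_toPoly, hT]
    simp
  by_cases htriv : d = 0 ∨ K = 0
  -- Only constants remain, so one sample suffices: the tail with `D = 0` is zero, and the trivial
  -- `β = 0` will do.
  · refine (measure_degenerate_succ_le_binomTail measurable_predictorMap (β := 0) le_rfl
      zero_le_one (fun p _ => by simp) (D := 0) ?_
      Submodule.mem_top hTne).trans (by rw [binomTail]; exact (Real.exp_pos _).le)
    rw [finrank_top]
    exact finrank_coeffs_le_one htriv _
  obtain ⟨hd, hK⟩ := not_or.1 htriv
  obtain ⟨y, hy, hyN⟩ : ∃ y : ℝ, 0 < y ∧ ((n + 1 : ℕ) : ℝ) = y ^ 12 := by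
    refine ⟨((n + 1 : ℕ) : ℝ) ^ (1 / 12 : ℝ), Real.rpow_pos_of_pos (by positivity) _, ?_⟩
    rw [← Real.rpow_natCast, ← Real.rpow_mul (by positivity)]
    norm_num
  have hy3 : ((n + 1 : ℕ) : ℝ) ^ (1 / 4 : ℝ) = y ^ 3 := by
    rw [hyN, ← Real.rpow_natCast, ← Real.rpow_mul hy.le, ← Real.rpow_natCast]
    norm_num
  rw [hy3]
  rw [hyN] at hN
  -- One sample is spent on the constant; at least one more is needed for `n ≥ (n + 1) / 2`.
  have hn : 1 ≤ n := by
    have h2 : (1 : ℝ) ≤ (d : ℝ) ^ (24 * K) :=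
      one_le_pow₀ (by exact_mod_cast Nat.one_le_iff_ne_zero.2 hd)
    have h3 : (1 : ℝ) < ((n + 1 : ℕ) : ℝ) := by
      rw [hyN]
      refine h2.trans_lt (hN.trans_le ?_)
      exact mul_le_of_le_one_right (by positivity) (pow_le_one₀ h0.le h1)
    have h4 : 1 < n + 1 := by exact_mod_cast h3
    omega
  have hβ0 : ∀ M : ℕ, 0 ≤ (ρ / 4) ^ M := fun M => by positivity
  have hβ1 : ∀ M : ℕ, (ρ / 4) ^ M ≤ 1 := fun M => pow_le_one₀ (by positivity) (by linarith)
  rcases Nat.eq_or_lt_of_le (Nat.one_le_iff_ne_zero.2 hd) with rfl | hd2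
  · have hw := hP.one_le_omegaP (Nat.one_le_iff_ne_zero.2 hK)
    refine (measure_degenerate_succ_le_binomTail measurable_predictorMap (hβ0 (omegaP P K))
      (hβ1 _) (fun p hp => hP.measure_predictorMap_eq_zero_le h0 h1 hρ hp
        (totalDegree_toPoly_le_omega p)) (D := omegaP P K) ?_ Submodule.mem_top hTne).trans ?_
    · rw [finrank_top]
      exact finrank_coeffs_one_le K _
    · refine binomTail_le_exp (hβ0 _) (hβ1 _) hw hn hy hyN
        (numerics_univariate h0 h1 hy hw (le_omega_iff.1 le_rfl).2 ?_ (by simpa using hN))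
      refine le_trans ?_ (hP.four_pow_mul_hankelRatio_le
        (hP.lt_encard_of_le_omegaP (j := omegaP P K) (K := K) le_rfl))
      gcongr
      exact hρ _ le_rfl
  · refine (measure_degenerate_succ_le_binomTail measurable_predictorMap (hβ0 K)
      (hβ1 _) (fun p hp => hP.measure_predictorMap_eq_zero_le h0 h1 hρ hp
        (totalDegree_toPoly_le p)) (D := d ^ (2 * K)) ?_ Submodule.mem_top hTne).trans ?_
    · rw [finrank_top]
      exact (finrank_coeffs_le_pow hd2 (Nat.one_le_iff_ne_zero.2 hK) _).trans (Nat.le_succ _)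
    · exact binomTail_le_exp (hβ0 _) (hβ1 _) (Nat.one_le_pow _ _ (by omega)) hn hy hyN
        (Or.inr (numerics_multivariate h0 h1 hy hd2 (Nat.one_le_iff_ne_zero.2 hK) hN))

/-! ### Transfer to random samples -/

section Sampling

variable {Ω : Type*} [MeasurableSpace Ω] {μ : Measure Ω} {d N : ℕ}
  {X : Fin N → Ω → Fin d → ℝ} {D : Measure (Fin d → ℝ)}

theorem IsIIDSample.map_eq_pi [IsProbabilityMeasure μ] (hX : IsIIDSample μ X D) :
    μ.map (fun ω i => X i ω) = Measure.pi fun _ : Fin N => D := by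
  rw [(iIndepFun_iff_map_fun_eq_pi_map fun i => (hX.measurable i).aemeasurable).1 hX.indep]
  simp only [hX.law]

/-- An inequality rather than an equality, so that `s` need not be measurable. -/
theorem IsIIDSample.measure_le [IsProbabilityMeasure μ] (hX : IsIIDSample μ X D)
    (s : Set (Fin N → Fin d → ℝ)) :
    μ {ω | (fun i => X i ω) ∈ s} ≤ (Measure.pi fun _ : Fin N => D) s := by
  rw [← hX.map_eq_pi]
  exact Measure.le_map_apply (measurable_pi_lambda _ hX.measurable).aemeasurable s

theorem IsIIDSample.ae_mem_support {P : Measure ℝ} [IsProbabilityMeasure P]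
    (hX : IsIIDSample μ X (Measure.pi fun _ => P)) : ∀ᵐ ω ∂μ, ∀ i j, X i ω j ∈ P.support := by
  rw [ae_all_iff]
  intro i
  rw [ae_all_iff]
  intro j
  have h : ∀ᵐ x ∂(μ.map (X i)), x j ∈ P.support := by
    rw [hX.law i]
    exact (measurePreserving_eval (fun _ : Fin d => P) j).quasiMeasurePreserving.ae
      Measure.support_mem_ae
  exact ae_of_ae_map (hX.measurable i).aemeasurable h

end Sampling

/-! ### The two recovery statements -/

theorem ae_recovers_of_absolutelyContinuous {d m L k N : ℕ} (hL : 1 ≤ L) {σ : Polynomial ℝ}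
    (hσ : σ.natDegree = k) (w : Weights d m L) {D : Measure (Fin d → ℝ)} (hD : D ≪ volume)
    {Ω : Type*} [MeasurableSpace Ω] {μ : Measure Ω} [IsProbabilityMeasure μ]
    {X : Fin N → Ω → Fin d → ℝ} (hX : IsIIDSample μ X D)
    (hN : ∑ t ∈ Finset.range (k ^ L + 1), (multiplicities d t t).card ≤ N) :
    ∀ᵐ ω ∂μ, Recovers (fun i => X i ω) (fun i => w.eval (fun z => σ.eval z) (X i ω)) (k ^ L) ⊤
      (w.eval fun z => σ.eval z) Set.univ := by
  obtain ⟨F, hF, hFe⟩ := w.exists_eval_eq_eval hL σ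
  rw [hσ] at hF
  obtain ⟨T, rfl⟩ := exists_toPoly_eq (card := ⊤) hF (by simp)
  -- The term `t = 0` contributes 1, so there is a sample; `D` is a probability measure because it
  -- is the law of one.
  have hNpos : 0 < N := by
    refine lt_of_lt_of_le ?_ hN
    rw [Finset.sum_range_succ']
    simp [card_multiplicities_self]
  have hDprob : IsProbabilityMeasure D := by
    rw [← hX.law ⟨0, hNpos⟩]
    exact Measure.isProbabilityMeasure_map (hX.measurable _).aemeasurable
  have hzero : ∀ p : Coeffs d (k ^ L) ⊤, p ≠ 0 →
      D.real {x | predictorMap d (k ^ L) ⊤ p x = 0} ≤ 1 - 1 := by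
    intro p hp
    have h := measure_pi_eval_eq_zero (P := volume) (toPoly_ne_zero hp)
    rw [← volume_pi] at h
    simp only [eval_toPoly] at h
    rw [sub_self, measureReal_def]
    exact le_of_eq (by simp [predictorMap_apply, hD h])
  have hfin : Module.finrank ℝ (Coeffs d (k ^ L) ⊤) ≤ N := by
    rw [finrank_coeffs]
    refine le_trans (Finset.sum_le_sum fun t _ => le_of_eq ?_) hN
    simp [omega]
  have h := measure_degenerate_le_binomTail measurable_predictorMap zero_le_one le_rfl hzero
    ((finrank_top ℝ _).le.trans hfin) (n := N)
  rw [binomTail_one_eq_zero le_rfl] at h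
  have hnull := (measureReal_eq_zero_iff).1 (le_antisymm h measureReal_nonneg)
  have hae := measure_eq_zero_iff_ae_notMem.1 (le_antisymm
    ((hX.measure_le _).trans hnull.le) zero_le)
  filter_upwards [hae] with ω hω
  exact recovers_of_notMem_degenerate hω T (fun i => by rw [hFe, eval_toPoly])
    fun x _ => by rw [hFe, eval_toPoly]

/-- One degenerate event controls both conclusions, so no union bound is needed. -/
theorem measure_not_recovers_le {d m L k N : ℕ} (hL : 1 ≤ L) {σ : Polynomial ℝ}
    (hσ : σ.natDegree = k) (w : Weights d m L) {P : Measure ℝ} (hP : IsAdmissible P)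
    {Ω : Type*} [MeasurableSpace Ω] {μ : Measure Ω} [IsProbabilityMeasure μ]
    {X : Fin N → Ω → Fin d → ℝ} (hX : IsIIDSample μ X (Measure.pi fun _ => P))
    (hN : (d : ℝ) ^ (24 * k ^ L) * condConst P (k ^ L) ^ 4 < (N : ℝ)) :
    μ {ω | ¬ (Recovers (fun i => X i ω) (fun i => w.eval (fun z => σ.eval z) (X i ω)) (k ^ L)
              P.support.encard (w.eval fun z => σ.eval z) {x | ∀ i, x i ∈ P.support} ∧
            (((k ^ L : ℕ) : ℕ∞) < P.support.encard →
              Recovers (fun i => X i ω) (fun i => w.eval (fun z => σ.eval z) (X i ω)) (k ^ L)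
                P.support.encard (w.eval fun z => σ.eval z) Set.univ))}
      ≤ ENNReal.ofReal (Real.exp (-(1 / 16) * (N : ℝ) ^ (1 / 4 : ℝ))) := by
  have := hP.isProbabilityMeasure
  obtain ⟨F, hF, hFe⟩ := w.exists_eval_eq_eval hL σ
  rw [hσ] at hF
  have hSne : P.support.Nonempty := Set.encard_ne_zero.1
    (zero_lt_one.trans hP.one_lt_encard_support).ne'
  obtain ⟨G, hG, hGc, hGF⟩ := exists_reduced_eq_on hSne F
  obtain ⟨T, rfl⟩ := exists_toPoly_eq (hG.trans hF) hGc
  have hTF : ∀ x : Fin d → ℝ, (∀ i, x i ∈ P.support) →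
      w.eval (fun z => σ.eval z) x = predictor T x := fun x hx => by
    rw [hFe, ← hGF x hx, eval_toPoly]
  set bad := degenerate (predictorMap d (k ^ L) P.support.encard) ⊤ N with hbad
  have hsub : μ {ω | ¬ (Recovers (fun i => X i ω) (fun i => w.eval (fun z => σ.eval z) (X i ω))
              (k ^ L) P.support.encard (w.eval fun z => σ.eval z) {x | ∀ i, x i ∈ P.support} ∧
            (((k ^ L : ℕ) : ℕ∞) < P.support.encard →
              Recovers (fun i => X i ω) (fun i => w.eval (fun z => σ.eval z) (X i ω)) (k ^ L)
                P.support.encard (w.eval fun z => σ.eval z) Set.univ))}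
      ≤ μ {ω | (fun i => X i ω) ∈ bad} := by
    -- The inclusion holds only almost surely: the labels match the reduced polynomial only at
    -- samples in the support.
    refine measure_mono_ae ?_
    filter_upwards [hX.ae_mem_support] with ω hω hnot
    by_contra hgood
    refine hnot ⟨recovers_of_notMem_degenerate hgood T (fun i => hTF _ (hω i)) hTF, fun hlt => ?_⟩
    -- When `|S| > k ^ L` the degree cap is inactive, so the network polynomial itself is
    -- representable and agreement extends to all of space.
    obtain ⟨T', rfl⟩ := exists_toPoly_eq (card := P.support.encard) hF fun i => by
      refine le_trans ?_ (ENat.le_sub_one_of_lt hlt)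
      exact_mod_cast (MvPolynomial.degreeOf_le_totalDegree F i).trans hF
    exact recovers_of_notMem_degenerate hgood T' (fun i => by rw [hFe, eval_toPoly])
      fun x _ => by rw [hFe, eval_toPoly]
  refine hsub.trans ((hX.measure_le bad).trans ?_)
  rw [← ofReal_measureReal]
  exact ENNReal.ofReal_le_ofReal (hP.measure_degenerate_le hN)

end PolyNet

theorem mainTheorem6 :
    (∃ c' : ℝ, 0 < c' ∧
      ∀ (d m L k N : ℕ), 1 ≤ L →
      ∀ σ : Polynomial ℝ, σ.natDegree = k →
      ∀ w : PolyNet.Weights d m L,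
      ∀ P : MeasureTheory.Measure ℝ, PolyNet.IsAdmissible P →
      ∀ (Ω : Type*) [MeasurableSpace Ω] (μ : MeasureTheory.Measure Ω)
        [MeasureTheory.IsProbabilityMeasure μ] (X : Fin N → Ω → Fin d → ℝ),
        PolyNet.IsIIDSample μ X (MeasureTheory.Measure.pi fun _ => P) →
        (d : ℝ) ^ (24 * k ^ L) * PolyNet.condConst P (k ^ L) ^ 4 < (N : ℝ) →
        μ {ω | ¬ (PolyNet.Recovers (fun i => X i ω)
                    (fun i => w.eval (fun z => σ.eval z) (X i ω)) (k ^ L) P.support.encard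
                    (w.eval fun z => σ.eval z) {x | ∀ i, x i ∈ P.support} ∧
                  (((k ^ L : ℕ) : ℕ∞) < P.support.encard →
                    PolyNet.Recovers (fun i => X i ω)
                      (fun i => w.eval (fun z => σ.eval z) (X i ω)) (k ^ L) P.support.encard
                      (w.eval fun z => σ.eval z) Set.univ))}
          ≤ ENNReal.ofReal (Real.exp (-c' * (N : ℝ) ^ (1 / 4 : ℝ)))) ∧
    (∀ (d m L k N : ℕ), 1 ≤ L →
      ∀ σ : Polynomial ℝ, σ.natDegree = k →
      ∀ w : PolyNet.Weights d m L,
      ∀ D : MeasureTheory.Measure (Fin d → ℝ),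
        MeasureTheory.Measure.AbsolutelyContinuous D MeasureTheory.volume →
      ∀ (Ω : Type*) [MeasurableSpace Ω] (μ : MeasureTheory.Measure Ω)
        [MeasureTheory.IsProbabilityMeasure μ] (X : Fin N → Ω → Fin d → ℝ),
        PolyNet.IsIIDSample μ X D →
        ∑ t ∈ Finset.range (k ^ L + 1), (PolyNet.multiplicities d t t).card ≤ N →
        ∀ᵐ ω ∂μ, PolyNet.Recovers (fun i => X i ω)
            (fun i => w.eval (fun z => σ.eval z) (X i ω)) (k ^ L) ⊤
            (w.eval fun z => σ.eval z) Set.univ) ∧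
    (∀ d K : ℕ,
      ∑ t ∈ Finset.range (K + 1), (PolyNet.multiplicities d t t).card
        = ∑ t ∈ Finset.range (K + 1), (d + t - 1).choose t) := by
  refine ⟨⟨1 / 16, by norm_num, ?_⟩, ?_, fun d K => ?_⟩
  · intro d m L k N hL σ hσ w P hP Ω _ μ _ X hX hN
    exact PolyNet.measure_not_recovers_le hL hσ w hP hX hN
  · intro d m L k N hL σ hσ w D hD Ω _ μ _ X hX hN
    exact PolyNet.ae_recovers_of_absolutelyContinuous hL hσ w hD hX hN
  · exact Finset.sum_congr rfl fun t _ => PolyNet.card_multiplicities_self d t
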